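/- **Setting.** Let $\Theta\subseteq\mathbb R^p$ and let $\{f(\cdot;\theta):\theta\in\Theta\}$ be a family of probability densities on $\mathbb R^m$ (with respect to Lebesgue measure); $P_\theta$ and $E_\theta$ are the corresponding distribution and expectation. For $k=1,\dots,K$ let $f_{A_k}(y;\theta)$ be the conditional density of the coordinates $y_j$, $j\in A_k$, given the coordinates $y_j$, $j\in B_k$, where $A_k\neq\emptyset$ and $B_k$ are disjoint subsets of $\{1,\dots,m\}$ (for $B_k=\emptyset$ it is a marginal density), let $w_k\ge 0$ be known weights, and put $$\ell_{A_k}=\log f_{A_k},\qquad c\ell(\theta,y)=\sum_{k=1}^K w_k\,\ell_{A_k}(\theta,y),\qquad u(\theta,y)=\frac{\partial c\ell(\theta,y)}{\partial\theta},$$ $$H(\theta)=E_\theta\Big[-\frac{\partial}{\partial\theta}u^T(\theta,Y)\Big],\qquad J(\theta)=\mathrm{Var}_\theta[u(\theta,Y)].$$ Let $r<p$ and $g:\mathbb R^p\to\mathbb R^r$ be such that the $p\times r$ matrix $G(t)=\partial g^T(t)/\partial t$ exists and is continuous in the interior of $\Theta$. (Only the values of $g$ on $\Theta$ matter.) Let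 $\theta$ be the true parameter value, with $g(\theta)=0_r$ and $\mathrm{rank}\,G(\theta)=r$, and assume that $H(\theta)$ and $J(\theta)$ are positive definite and that the following standard regularity conditions hold with some open neighbourhood $U\subseteq\Theta$ of $\theta$: 1. $P_t\ll P_\theta$ for all $t\in\Theta$, and for $P_\theta$-almost every $y$ one has $f_{A_k}(y;t)>0$ for all $t\in\Theta$ and all $k$; 2. for each $k$ and $P_\theta$-almost every $y$, $t\mapsto\ell_{A_k}(t,y)$ is twice continuously differentiable on $U$; 3. for each $k$ there are $P_\theta$-integrable functions $b_k,b_k'$ such that, for $P_\theta$-almost every $y$ and all $t\in U$, $\|\partial f_{A_k}(y;t)/\partial t\|\le b_k(y)f_{A_k}(y;\theta)$ and $\|\partial^2\ell_{A_k}(t,y)/\partial t\,\partial t^T\|\le b_k'(y)$; 4. $E_\theta\|u(\theta,Y)\|^2<\infty$. Let $Y_1,Y_2,\dots$ be independent with distribution $P_\theta$. A *restricted maximum composite likelihood estimate* from $Y_1,\dots,Y_n$ is a maximizer of $t\mapsto\sum_{i=1}^n c\ell(t,Y_i)$ over $\{t\in\Theta: g(t)=0_r\}$; the *restricted likelihood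 equations* for $t\in\Theta$ are $$\sum_{i=1}^n\frac{\partial}{\partial t}c\ell(t,Y_i)+G(t)\lambda=0_p,\qquad g(t)=0_r,\qquad\text{for some }\lambda\in\mathbb R^r.$$ Put $$Q(\theta)=-H^{-1}(\theta)G(\theta)\big[G^T(\theta)H^{-1}(\theta)G(\theta)\big]^{-1},\qquad P(\theta)=H^{-1}(\theta)+Q(\theta)G^T(\theta)H^{-1}(\theta).$$ **Theorem.** (a) Let $\tilde\theta_{rc}=\tilde\theta_{rc,n}$ be random vectors, consistent for $\theta$ (that is, $\tilde\theta_{rc,n}\to\theta$ in probability), such that, with probability tending to one, $\tilde\theta_{rc,n}$ is a restricted maximum composite likelihood estimate or a solution of the restricted likelihood equations. Then $$\sqrt n\,(\tilde\theta_{rc}-\theta)\ \xrightarrow[n\to\infty]{\mathcal L}\ \mathcal N\big(0_p,\;P(\theta)J(\theta)P^T(\theta)\big).$$ (b) There are measurable functions $\tilde\theta_{rc,n}$ of $(Y_1,\dots,Y_n)$ that are consistent for $\theta$, that with probability tending to one solve the restricted likelihood equations and are local maximizers of the composite log-likelihood over $\{t\in\Theta:g(t)=0_r\}$, and that therefore have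 the asymptotic distribution in (a). (As usual for consistent roots of likelihood equations, the choice of the functions may depend on $\theta$.) -/

import Mathlib

open MeasureTheory ProbabilityTheory Filter Topology
open scoped ENNReal Matrix

/-- A parametric family of probability densities `f θ` (with respect to Lebesgue measure on `ℝ^m`,
for `θ` in the parameter space `Θ ⊆ ℝ^p`), together with the recipe of a composite likelihood:
`K` components, the `k`-th one being the conditional density of the coordinates in `A k` given the
coordinates in `B k` (a marginal density if `B k = ∅`), with known weight `w k ≥ 0`. -/
structure CompositeModel (p m K : ℕ) where
  Θ : Set (EuclideanSpace ℝ (Fin p))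
  f : EuclideanSpace ℝ (Fin p) → (Fin m → ℝ) → ℝ≥0∞
  measurable_f : ∀ θ ∈ Θ, Measurable (f θ)
  lintegral_f : ∀ θ ∈ Θ, ∫⁻ y, f θ y = 1
  A : Fin K → Finset (Fin m)
  B : Fin K → Finset (Fin m)
  nonempty_A : ∀ k, (A k).Nonempty
  disjoint_AB : ∀ k, Disjoint (A k) (B k)
  w : Fin K → ℝ
  w_nonneg : ∀ k, 0 ≤ w k

namespace CompositeModel

variable {p m K r : ℕ}

/-- The distribution `P_θ` of one observation. -/
noncomputable def law (M : CompositeModel p m K) (θ : EuclideanSpace ℝ (Fin p)) :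
    Measure (Fin m → ℝ) :=
  volume.withDensity (M.f θ)

/-- The marginal density of the coordinates in `S`: the other coordinates are integrated out.
It is written as a function of all of `y` but depends only on `y j`, `j ∈ S`. -/
noncomputable def marginal (M : CompositeModel p m K) (S : Finset (Fin m))
    (θ : EuclideanSpace ℝ (Fin p)) (y : Fin m → ℝ) : ℝ≥0∞ :=
  lmarginal (fun _ => (volume : Measure ℝ)) Sᶜ (M.f θ) y

/-- The `k`-th component density: the conditional density of `y_{A k}` given `y_{B k}`. -/
noncomputable def component (M : CompositeModel p m K) (k : Fin K)
    (θ : EuclideanSpace ℝ (Fin p)) (y : Fin m → ℝ) : ℝ :=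
  (M.marginal (M.A k ∪ M.B k) θ y / M.marginal (M.B k) θ y).toReal

/-- The `k`-th component log-density. -/
noncomputable def logComponent (M : CompositeModel p m K) (k : Fin K)
    (θ : EuclideanSpace ℝ (Fin p)) (y : Fin m → ℝ) : ℝ :=
  Real.log (M.component k θ y)

/-- The composite log-density `cℓ(θ, y) = ∑ₖ wₖ log f_{Aₖ}(y; θ)`. -/
noncomputable def compositeLogDensity (M : CompositeModel p m K)
    (θ : EuclideanSpace ℝ (Fin p)) (y : Fin m → ℝ) : ℝ :=
  ∑ k, M.w k * M.logComponent k θ y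

/-- The composite log-likelihood of a sample `x 0, …, x (n - 1)`. -/
noncomputable def compositeLogLik (M : CompositeModel p m K) {n : ℕ} (x : Fin n → Fin m → ℝ)
    (θ : EuclideanSpace ℝ (Fin p)) : ℝ :=
  ∑ i, M.compositeLogDensity θ (x i)

/-- The composite score `u(θ, y) = ∂ cℓ(θ, y) / ∂θ`. -/
noncomputable def score (M : CompositeModel p m K)
    (θ : EuclideanSpace ℝ (Fin p)) (y : Fin m → ℝ) : EuclideanSpace ℝ (Fin p) :=
  gradient (fun t => M.compositeLogDensity t y) θ

/-- The sensitivity matrix `H(θ) = E_θ[-∂ uᵀ(θ, Y) / ∂θ]`. -/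
noncomputable def sensitivity (M : CompositeModel p m K) (θ : EuclideanSpace ℝ (Fin p)) :
    Matrix (Fin p) (Fin p) ℝ :=
  Matrix.of fun i j =>
    ∫ y, -(fderiv ℝ (fun t => M.score t y) θ (EuclideanSpace.single i 1)) j ∂(M.law θ)

/-- The variability matrix `J(θ) = Var_θ[u(θ, Y)]`. -/
noncomputable def variability (M : CompositeModel p m K) (θ : EuclideanSpace ℝ (Fin p)) :
    Matrix (Fin p) (Fin p) ℝ :=
  Matrix.of fun i j => cov[fun y => M.score θ y i, fun y => M.score θ y j; M.law θ]

/-- The `p × r` matrix `G(θ) = ∂ gᵀ(θ) / ∂θ`. -/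
noncomputable def constraintJacobian
    (g : EuclideanSpace ℝ (Fin p) → EuclideanSpace ℝ (Fin r)) (θ : EuclideanSpace ℝ (Fin p)) :
    Matrix (Fin p) (Fin r) ℝ :=
  Matrix.of fun i j => (fderiv ℝ g θ (EuclideanSpace.single i 1)) j

/-- `Q(θ) = -H⁻¹ G (Gᵀ H⁻¹ G)⁻¹`. -/
noncomputable def matrixQ (M : CompositeModel p m K)
    (g : EuclideanSpace ℝ (Fin p) → EuclideanSpace ℝ (Fin r)) (θ : EuclideanSpace ℝ (Fin p)) :
    Matrix (Fin p) (Fin r) ℝ :=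
  -((M.sensitivity θ)⁻¹ * constraintJacobian g θ *
    ((constraintJacobian g θ)ᵀ * (M.sensitivity θ)⁻¹ * constraintJacobian g θ)⁻¹)

/-- `P(θ) = H⁻¹ + Q Gᵀ H⁻¹`. -/
noncomputable def matrixP (M : CompositeModel p m K)
    (g : EuclideanSpace ℝ (Fin p) → EuclideanSpace ℝ (Fin r)) (θ : EuclideanSpace ℝ (Fin p)) :
    Matrix (Fin p) (Fin p) ℝ :=
  (M.sensitivity θ)⁻¹ + M.matrixQ g θ * (constraintJacobian g θ)ᵀ * (M.sensitivity θ)⁻¹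

/-- The asymptotic covariance matrix `P(θ) J(θ) P(θ)ᵀ`. -/
noncomputable def restrictedCovariance (M : CompositeModel p m K)
    (g : EuclideanSpace ℝ (Fin p) → EuclideanSpace ℝ (Fin r)) (θ : EuclideanSpace ℝ (Fin p)) :
    Matrix (Fin p) (Fin p) ℝ :=
  M.matrixP g θ * M.variability θ * (M.matrixP g θ)ᵀ

/-- The restricted parameter space `{θ ∈ Θ : g(θ) = 0}`. -/
def restrictedSpace (M : CompositeModel p m K)
    (g : EuclideanSpace ℝ (Fin p) → EuclideanSpace ℝ (Fin r)) : Set (EuclideanSpace ℝ (Fin p)) :=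
  {t | t ∈ M.Θ ∧ g t = 0}

/-- `t` is a restricted maximum composite likelihood estimate for the sample `x`: it maximizes
the composite log-likelihood over the restricted parameter space. -/
def IsRestrictedMCLE (M : CompositeModel p m K)
    (g : EuclideanSpace ℝ (Fin p) → EuclideanSpace ℝ (Fin r)) {n : ℕ} (x : Fin n → Fin m → ℝ)
    (t : EuclideanSpace ℝ (Fin p)) : Prop :=
  t ∈ M.restrictedSpace g ∧ IsMaxOn (M.compositeLogLik x) (M.restrictedSpace g) t

/-- `t` is a local restricted maximizer of the composite log-likelihood of the sample `x`. -/
def IsLocalRestrictedMCLE (M : CompositeModel p m K)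
    (g : EuclideanSpace ℝ (Fin p) → EuclideanSpace ℝ (Fin r)) {n : ℕ} (x : Fin n → Fin m → ℝ)
    (t : EuclideanSpace ℝ (Fin p)) : Prop :=
  t ∈ M.restrictedSpace g ∧ IsLocalMaxOn (M.compositeLogLik x) (M.restrictedSpace g) t

/-- `t` solves the restricted likelihood equations
`∑ᵢ ∂cℓ(t, xᵢ)/∂θ + G(t) lam = 0`, `g(t) = 0`, with some vector `lam` of Lagrange multipliers. -/
def SolvesRestrictedEquations (M : CompositeModel p m K)
    (g : EuclideanSpace ℝ (Fin p) → EuclideanSpace ℝ (Fin r)) {n : ℕ} (x : Fin n → Fin m → ℝ)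
    (t : EuclideanSpace ℝ (Fin p)) : Prop :=
  t ∈ M.restrictedSpace g ∧ ∃ lam : Fin r → ℝ, ∀ a : Fin p,
    (∑ i, M.score t (x i) a) + (constraintJacobian g t *ᵥ lam) a = 0

/-- The standard regularity conditions at the parameter value `θ`, with `U` a neighbourhood of `θ`
in the parameter space. -/
structure IsRegularAt (M : CompositeModel p m K) (θ : EuclideanSpace ℝ (Fin p))
    (U : Set (EuclideanSpace ℝ (Fin p))) : Prop where
  isOpen : IsOpen U
  mem : θ ∈ U
  subset : U ⊆ M.Θ
  /-- The support does not depend on the parameter. -/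
  absolutelyContinuous : ∀ t ∈ M.Θ, M.law t ≪ M.law θ
  component_pos : ∀ᵐ y ∂(M.law θ), ∀ t ∈ M.Θ, ∀ k, 0 < M.component k t y
  /-- Smoothness of the component log-densities in the parameter. -/
  contDiffOn : ∀ k, ∀ᵐ y ∂(M.law θ), ContDiffOn ℝ 2 (fun t => M.logComponent k t y) U
  /-- First derivatives of the component densities are dominated: the bound is
  `b(y) f_{Aₖ}(y; θ)` with `E_θ[b(Y)] < ∞`. -/
  dominated_deriv : ∀ k, ∃ b : (Fin m → ℝ) → ℝ, Integrable b (M.law θ) ∧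
    ∀ᵐ y ∂(M.law θ), ∀ t ∈ U,
      ‖fderiv ℝ (fun s => M.component k s y) t‖ ≤ b y * M.component k θ y
  /-- Second derivatives of the component log-densities are dominated. -/
  dominated_hessian : ∀ k, ∃ b : (Fin m → ℝ) → ℝ, Integrable b (M.law θ) ∧
    ∀ᵐ y ∂(M.law θ), ∀ t ∈ U,
      ‖iteratedFDeriv ℝ 2 (fun s => M.logComponent k s y) t‖ ≤ b y
  /-- The score has finite second moments. -/
  score_memLp : MemLp (M.score θ) 2 (M.law θ)

end CompositeModel

/-!
A restricted composite likelihood estimator is an M-estimator under a smooth constraint. Write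
`D = fderiv ℝ g θ`, whose adjoint is the matrix `G(θ)`, and let `s` be the average score. The
restricted equations say `s(t) + D(t)† l = 0` and `g(t) = 0`. A uniform law of large numbers for the
Hessians near `θ` (`SmoothCriterion.exists_holdsWHP_norm_average_gradient_sub_le`) gives
`s(t) ≈ s(θ) - H (t - θ)`. Since `P H = 1 + Q D` and `P D† = 0`, applying `P` removes the multiplier
and turns the equations into `t - θ ≈ P s(θ)`, with an error small relative to `s(θ)`
(`exists_norm_sub_le_of_restricted_equation`). The score has mean zero, because the expected density
ratio `t ↦ E_θ[f_k(Y; t) / f_k(Y; θ)]` is at most `1` with equality at `θ`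
(`CompositeModel.IsRegularAt.integrable_fderiv_logComponent`). So the central limit theorem applies
to `√n s(θ)`, and `√n (θ̃ - θ) = P (√n s(θ)) + o_p(1)` has the limit `N(0, P J Pᵀ)`. Maximizers reduce
to solutions of the equations by the Lagrange multiplier theorem.

For existence, `H` is positive definite, so near `θ` the average criterion lies, with probability
tending to one, below a concave parabola touching it at `θ`. A maximizer over the constraint set in a
fixed small closed ball is therefore at distance `O(‖s(θ)‖)` from `θ`: it is consistent, lies in the
open ball, and so is a local maximizer (`exists_measurable_consistent_local_maximizer`). It is
measurable in the sample because a compact metric space is a continuous image of the Cantor set, where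
the least maximizing parameter is a measurable choice (`exists_measurable_maximizer`).

The conditions on the model hold almost surely. The composite log-density is replaced by `0` on a
measurable null set of observations (`CompositeModel.IsRegularAt.exists_smoothCriterion`), after which
they hold for every observation and the asymptotic argument concerns a general `SmoothCriterion`.
-/

/-! ### Constrained criteria: multipliers and linearization -/

section Constraint

variable {E F : Type*} [NormedAddCommGroup E] [InnerProductSpace ℝ E] [FiniteDimensional ℝ E]
  [NormedAddCommGroup F] [InnerProductSpace ℝ F] [FiniteDimensional ℝ F]

open ContinuousLinearMap (adjoint)

theorem exists_norm_le_mul_norm_adjoint {D : E →L[ℝ] F} (hD : Function.Surjective D) :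
    ∃ κ > 0, ∀ l, ‖l‖ ≤ κ * ‖adjoint D l‖ := by
  have hinj : LinearMap.ker (adjoint D).toLinearMap = ⊥ := by
    rw [LinearMap.ker_eq_bot']
    intro l hl
    obtain ⟨x, rfl⟩ := hD l
    have : inner ℝ (D x) (D x) = 0 := by
      rw [← ContinuousLinearMap.adjoint_inner_right]
      change inner ℝ x ((adjoint D).toLinearMap (D x)) = 0
      rw [hl, inner_zero_right]
    exact inner_self_eq_zero.1 this
  obtain ⟨κ, hκ, h⟩ := LinearMap.exists_antilipschitzWith _ hinj
  refine ⟨κ, by exact_mod_cast hκ, fun l => ?_⟩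
  simpa using h.le_mul_dist l 0

/-- Surjectivity is an open condition on linear maps, in the quantitative form needed for the
multipliers: near `θ` the multiplier is controlled by `D(t)† l`. -/
theorem eventually_norm_le_mul_norm_adjoint {g : E → F} {θ : E}
    (hcont : ContinuousAt (fderiv ℝ g) θ) (hD : Function.Surjective (fderiv ℝ g θ)) :
    ∃ κ > 0, ∀ᶠ t in 𝓝 θ, ∀ l, ‖l‖ ≤ κ * ‖adjoint (fderiv ℝ g t) l‖ := by
  obtain ⟨κ, hκ, h⟩ := exists_norm_le_mul_norm_adjoint hD
  refine ⟨2 * κ, by positivity, ?_⟩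
  filter_upwards [Metric.continuousAt_iff'.1 hcont (1 / (2 * κ)) (by positivity)] with t ht l
  have h1 : ‖adjoint (fderiv ℝ g t) l - adjoint (fderiv ℝ g θ) l‖ ≤ 1 / (2 * κ) * ‖l‖ := by
    rw [← sub_apply, ← map_sub]
    refine (ContinuousLinearMap.le_opNorm _ _).trans ?_
    rw [LinearIsometryEquiv.norm_map, ← dist_eq_norm]
    gcongr
  have h2 := h l
  have h3 := norm_le_norm_add_norm_sub (adjoint (fderiv ℝ g t) l) (adjoint (fderiv ℝ g θ) l)
  have h4 : κ * (1 / (2 * κ) * ‖l‖) = ‖l‖ / 2 := by field_simp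
  nlinarith [mul_le_mul_of_nonneg_left h3 hκ.le, mul_le_mul_of_nonneg_left h1 hκ.le]

/-- Lagrange multipliers at a regular point of the constraint. -/
theorem exists_gradient_add_adjoint_eq_zero {g : E → F} {φ : E → ℝ} {t : E}
    (hmax : IsLocalMaxOn φ {x | g x = g t} t) (hg : HasStrictFDerivAt g (fderiv ℝ g t) t)
    (hφ : HasStrictFDerivAt φ (fderiv ℝ φ t) t)
    (hD : ∀ l, adjoint (fderiv ℝ g t) l = 0 → l = 0) :
    ∃ l : F, gradient φ t + adjoint (fderiv ℝ g t) l = 0 := by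
  obtain ⟨Λ, c, hne, h⟩ :=
    IsLocalExtrOn.exists_linear_map_of_hasStrictFDerivAt (Or.inr hmax) hg hφ
  set l : F := (InnerProductSpace.toDual ℝ F).symm (LinearMap.toContinuousLinearMap Λ) with hl
  have hΛ : ∀ y, Λ y = inner ℝ l y := fun y => by simp [hl]
  have key : adjoint (fderiv ℝ g t) l + c • gradient φ t = 0 := by
    refine ext_inner_right ℝ fun x => ?_
    have := h x
    rw [hΛ] at this
    rw [inner_add_left, inner_smul_left, ContinuousLinearMap.adjoint_inner_left,
      inner_gradient_left, inner_zero_left]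
    simpa using this
  have hc : c ≠ 0 := by
    rintro rfl
    have hl0 : l = 0 := hD l (by simpa using key)
    apply hne
    ext y
    · simp [hΛ, hl0]
    · rfl
  refine ⟨c⁻¹ • l, ?_⟩
  have := congrArg (c⁻¹ • ·) key
  simpa [smul_smul, inv_mul_cancel₀ hc, add_comm] using this

/-- The deterministic core of the asymptotic linearization. If `t` is close to `θ`, satisfies the
constraint and `s + D(t)† l = 0`, where `s` is up to a small relative error the linearization
`s₀ - H (t - θ)` of a score with value `s₀` at `θ`, then `t - θ` is close to `P s₀`. Here `P` is
characterized by `P H = 1 + Q D` and `P D† = 0`: applying `P` eliminates the multiplier. -/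
theorem exists_norm_sub_le_of_restricted_equation {g : E → F} {θ : E}
    (hdiff : DifferentiableAt ℝ g θ) (hcont : ContinuousAt (fderiv ℝ g) θ)
    (hD : Function.Surjective (fderiv ℝ g θ)) (hθ : g θ = 0)
    (H P : E →L[ℝ] E) (Q : F →L[ℝ] E) (hPH : ∀ v, P (H v) = v + Q (fderiv ℝ g θ v))
    (hPD : ∀ l, P (adjoint (fderiv ℝ g θ) l) = 0) {ε : ℝ} (hε : 0 < ε) :
    ∃ δ > 0, ∀ t, ‖t - θ‖ < δ → g t = 0 → ∀ s s₀ l, s + adjoint (fderiv ℝ g t) l = 0 →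
      ‖s - s₀ + H (t - θ)‖ ≤ δ * ‖t - θ‖ → ‖t - θ - P s₀‖ ≤ ε * ‖s₀‖ := by
  obtain ⟨κ, hκ, hev⟩ := eventually_norm_le_mul_norm_adjoint hcont hD
  set p := ‖P‖
  set h := ‖H‖
  set q := ‖Q‖
  have hp : 0 ≤ p := norm_nonneg P
  have hh : 0 ≤ h := norm_nonneg H
  have hq : 0 ≤ q := norm_nonneg Q
  -- the relative error that is tolerated in each of the three approximations
  obtain ⟨ρ, hρ, hρ1, hρε⟩ : ∃ ρ > 0, ρ ≤ 1 / 2 ∧ ρ * (2 * p + 2) ≤ ε :=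
    ⟨min (1 / 2) (ε / (2 * p + 2)), by positivity, min_le_left _ _, by
      calc _ ≤ ε / (2 * p + 2) * (2 * p + 2) := by gcongr; exact min_le_right _ _
        _ = ε := by field_simp⟩
  -- `c` bounds the sum of the factors with which these approximations enter `t - θ - P s₀`
  set c := p * κ * (h + 2) + p + q + 1 with hc
  have hcpos : 0 < c := by positivity
  set η := min 1 (ρ / c) with hη
  have hηpos : 0 < η := by positivity
  have hη1 : η ≤ 1 := min_le_left _ _
  have hηc : η * c ≤ ρ := by
    calc η * c ≤ ρ / c * c := by gcongr; exact min_le_right _ _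
      _ = ρ := by field_simp
  have hev1 : ∀ᶠ t in 𝓝 θ, ‖fderiv ℝ g t - fderiv ℝ g θ‖ < η := by
    simpa [dist_eq_norm] using Metric.continuousAt_iff'.1 hcont η hηpos
  have hev2 : ∀ᶠ t in 𝓝 θ, ‖g t - g θ - fderiv ℝ g θ (t - θ)‖ ≤ η * ‖t - θ‖ :=
    hdiff.hasFDerivAt.isLittleO.def hηpos
  obtain ⟨δ, hδ, hball⟩ := Metric.eventually_nhds_iff.1 (hev.and (hev1.and hev2))
  refine ⟨min δ η, lt_min hδ hηpos, fun t ht hgt s s₀ l hs hlin => ?_⟩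
  obtain ⟨h1, h2, h3⟩ := hball (y := t) (by rw [dist_eq_norm]; exact ht.trans_le (min_le_left _ _))
  set d := t - θ with hd
  have hd0 : 0 ≤ ‖d‖ := norm_nonneg d
  replace hlin : ‖s - s₀ + H d‖ ≤ η * ‖d‖ :=
    hlin.trans (by gcongr; exact min_le_right _ _)
  have hDd : ‖fderiv ℝ g θ d‖ ≤ η * ‖d‖ := by
    rw [hgt, hθ, sub_zero, zero_sub, norm_neg] at h3
    exact h3
  have hs_norm : ‖s‖ ≤ ‖s₀‖ + (h + 1) * ‖d‖ := by
    have : s = s₀ + ((s - s₀ + H d) - H d) := by abel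
    rw [this]
    refine (norm_add_le _ _).trans ?_
    have := norm_sub_le (s - s₀ + H d) (H d)
    have := H.le_opNorm d
    nlinarith
  have hl : ‖l‖ ≤ κ * ‖s‖ := by
    have := h1 l
    rwa [eq_neg_of_add_eq_zero_right hs, norm_neg] at this
  have hPs : ‖P s‖ ≤ p * (η * (κ * ‖s‖)) := by
    have : P s = -P (adjoint (fderiv ℝ g t - fderiv ℝ g θ) l) := by
      rw [map_sub, sub_apply, map_sub, hPD, sub_zero,
        eq_neg_of_add_eq_zero_right hs, map_neg, neg_neg]
    rw [this, norm_neg]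
    refine (P.le_opNorm _).trans ?_
    refine mul_le_mul_of_nonneg_left ?_ hp
    refine (ContinuousLinearMap.le_opNorm _ _).trans ?_
    rw [LinearIsometryEquiv.norm_map]
    exact mul_le_mul h2.le hl (norm_nonneg _) hηpos.le
  have hid : d - P s₀ = -P s + P (s - s₀ + H d) - Q (fderiv ℝ g θ d) := by
    rw [map_add, map_sub, hPH]; abel
  have hPe : ‖P (s - s₀ + H d)‖ ≤ p * (η * ‖d‖) :=
    (P.le_opNorm _).trans (mul_le_mul_of_nonneg_left hlin hp)
  have hQ : ‖Q (fderiv ℝ g θ d)‖ ≤ q * (η * ‖d‖) :=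
    (Q.le_opNorm _).trans (mul_le_mul_of_nonneg_left hDd hq)
  have hmain : ‖d - P s₀‖ ≤ ρ * (‖s₀‖ + ‖d‖) := by
    have e1 : ‖d - P s₀‖ ≤ ‖P s‖ + ‖P (s - s₀ + H d)‖ + ‖Q (fderiv ℝ g θ d)‖ := by
      rw [hid]
      refine (norm_sub_le _ _).trans (add_le_add_left ((norm_add_le _ _).trans ?_) _)
      rw [norm_neg]
    have e2 : p * (η * (κ * ‖s‖)) ≤ p * (η * (κ * ((h + 2) * (‖s₀‖ + ‖d‖)))) := by
      gcongr
      nlinarith [norm_nonneg s₀]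
    have e3 : p * (η * ‖d‖) ≤ p * (η * (‖s₀‖ + ‖d‖)) := by gcongr; simp
    have e4 : q * (η * ‖d‖) ≤ q * (η * (‖s₀‖ + ‖d‖)) := by gcongr; simp
    have e5 : η * c * (‖s₀‖ + ‖d‖) ≤ ρ * (‖s₀‖ + ‖d‖) := by gcongr
    have e6 : 0 ≤ η * (‖s₀‖ + ‖d‖) := by positivity
    rw [hc] at e5
    linarith
  have hdn : ‖d‖ ≤ ‖d - P s₀‖ + p * ‖s₀‖ := by
    have := norm_add_le (d - P s₀) (P s₀)
    rw [sub_add_cancel] at this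
    exact this.trans (by gcongr; exact P.le_opNorm _)
  have hs0 : 0 ≤ ‖s₀‖ := norm_nonneg _
  have hd2 : ‖d‖ ≤ (2 * p + 1) * ‖s₀‖ := by nlinarith
  calc ‖d - P s₀‖ ≤ ρ * (‖s₀‖ + ‖d‖) := hmain
    _ ≤ ρ * (‖s₀‖ + (2 * p + 1) * ‖s₀‖) := by gcongr
    _ = ρ * (2 * p + 2) * ‖s₀‖ := by ring
    _ ≤ ε * ‖s₀‖ := by gcongr

end Constraint

/-! ### Measurable selection of a maximizer -/

section Argmax

variable {X : Type*} [MeasurableSpace X] {C : Type*} [MetricSpace C] [CompactSpace C]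

theorem measurableSet_exists_maximizer_mem {F : X → C → ℝ}
    (hmeas : ∀ t, Measurable fun x => F x t) (hcont : ∀ x, Continuous (F x))
    {A : Set C} (hA : IsClosed A) :
    MeasurableSet {x | ∃ t ∈ A, ∀ s, F x s ≤ F x t} := by
  rcases A.eq_empty_or_nonempty with rfl | hne
  · simp
  obtain ⟨S, hSA, hSc, hSd⟩ :=
    (TopologicalSpace.IsSeparable.of_separableSpace A).exists_countable_dense_subset
  obtain ⟨D, hDc, hDd⟩ := TopologicalSpace.exists_countable_dense C
  -- the event is expressed through values at countably many points
  have key : {x | ∃ t ∈ A, ∀ s, F x s ≤ F x t} =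
      ⋂ s ∈ D, ⋂ n : ℕ, ⋃ a ∈ S, {x | F x s - 1 / ((n : ℝ) + 1) < F x a} := by
    ext x
    simp only [Set.mem_ofPred_eq, Set.mem_iInter, Set.mem_iUnion, exists_prop]
    constructor
    · rintro ⟨t, htA, ht⟩ s - n
      have hn : F x s - 1 / ((n : ℝ) + 1) < F x t := by
        have : (0 : ℝ) < 1 / ((n : ℝ) + 1) := by positivity
        linarith [ht s]
      obtain ⟨a, ha, haS⟩ := mem_closure_iff.1 (hSd htA) _
        (isOpen_lt continuous_const (hcont x)) hn
      exact ⟨a, haS, ha⟩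
    · intro h
      obtain ⟨t, htA, ht⟩ := hA.isCompact.exists_isMaxOn hne (hcont x).continuousOn
      refine ⟨t, htA, fun s => ?_⟩
      have hcl : IsClosed {s | F x s ≤ F x t} := isClosed_le (hcont x) continuous_const
      refine hcl.closure_subset_iff.2 (fun s hs => ?_) (hDd s)
      change F x s ≤ F x t
      refine le_of_forall_pos_le_add fun ε hε => ?_
      obtain ⟨n, hn⟩ := exists_nat_one_div_lt hε
      obtain ⟨a, haS, ha⟩ := h s hs n
      have : F x a ≤ F x t := ht (hSA haS)
      linarith
  rw [key]
  exact .biInter hDc fun s _ => .iInter fun n => .biUnion hSc fun a _ =>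
    measurableSet_lt ((hmeas s).sub_const _) (hmeas a)

/-- A function that is measurable in `x` and continuous on a compact metric space has a maximizer
that depends measurably on `x`. The space is parametrized by the Cantor set, where the least
maximizing parameter is a measurable choice. -/
theorem exists_measurable_maximizer [MeasurableSpace C] [BorelSpace C] [Nonempty C] {F : X → C → ℝ}
    (hmeas : ∀ t, Measurable fun x => F x t) (hcont : ∀ x, Continuous (F x)) :
    ∃ T : X → C, Measurable T ∧ ∀ x s, F x s ≤ F x (T x) := by
  obtain ⟨f, hf, hsurj⟩ := exists_nat_bool_continuous_surjective_of_compact C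
  set φ : cantorSet → C := f ∘ cantorSetHomeomorphNatToBool with hφ
  have hφc : Continuous φ := hf.comp cantorSetHomeomorphNatToBool.continuous
  have hφs : Function.Surjective φ := hsurj.comp cantorSetHomeomorphNatToBool.surjective
  have : CompactSpace cantorSet := isCompact_iff_compactSpace.1 isCompact_cantorSet
  have hex : ∀ x, ∃ c, IsLeast {c : cantorSet | ∀ s, F x s ≤ F x (φ c)} c := by
    intro x
    refine IsCompact.exists_isLeast (IsClosed.isCompact ?_) ?_
    · simp only [Set.ofPred_forall]
      exact isClosed_iInter fun s => isClosed_le continuous_const ((hcont x).comp hφc)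
    · obtain ⟨t, -, ht⟩ := isCompact_univ.exists_isMaxOn Set.univ_nonempty (hcont x).continuousOn
      obtain ⟨c, rfl⟩ := hφs t
      exact ⟨c, fun s => ht (Set.mem_univ s)⟩
  choose τ hτ using hex
  have hτm : Measurable τ := by
    refine (MeasurableEmbedding.subtype_coe isClosed_cantorSet.measurableSet).measurable_comp_iff.1
      (measurable_of_Iic fun a => ?_)
    have : (Subtype.val ∘ τ) ⁻¹' Set.Iic a =
        {x | ∃ c ∈ {c : cantorSet | (c : ℝ) ≤ a}, ∀ s, F x (φ s) ≤ F x (φ c)} := by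
      ext x
      constructor
      · exact fun h => ⟨τ x, h, fun s => (hτ x).1 _⟩
      · rintro ⟨c, hc, hmax⟩
        refine le_trans ?_ (show (c : ℝ) ≤ a from hc)
        refine Subtype.coe_le_coe.2 ((hτ x).2 fun s => ?_)
        obtain ⟨s', rfl⟩ := hφs s
        exact hmax s'
    rw [this]
    exact measurableSet_exists_maximizer_mem (F := fun x c => F x (φ c)) (fun c => hmeas _)
      (fun x => (hcont x).comp hφc) (isClosed_le continuous_subtype_val continuous_const)
  exact ⟨fun x => φ (τ x), hφc.measurable.comp hτm, fun x => (hτ x).1⟩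

end Argmax

/-! ### Events whose probability tends to one -/

section WithHighProbability

variable {Ω : Type*} [MeasurableSpace Ω] {μ : Measure Ω}

/-- The events `A n` hold with probability tending to one. They need not be measurable: the
complements tend to zero in outer measure. -/
def HoldsWHP (μ : Measure Ω) (A : ℕ → Ω → Prop) : Prop :=
  Tendsto (fun n => μ {ω | ¬ A n ω}) atTop (𝓝 0)

namespace HoldsWHP

variable {A B : ℕ → Ω → Prop}

theorem mono (hA : HoldsWHP μ A) (h : ∀ᶠ n in atTop, ∀ᵐ ω ∂μ, A n ω → B n ω) : HoldsWHP μ B := by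
  refine tendsto_of_tendsto_of_tendsto_of_le_of_le' tendsto_const_nhds hA
    (.of_forall fun _ => zero_le) ?_
  filter_upwards [h] with n hn
  exact measure_mono_ae (hn.mono fun ω hω hB hA => hB (hω hA))

theorem and (hA : HoldsWHP μ A) (hB : HoldsWHP μ B) : HoldsWHP μ fun n ω => A n ω ∧ B n ω := by
  have h := Tendsto.add hA hB
  rw [add_zero] at h
  refine tendsto_of_tendsto_of_tendsto_of_le_of_le tendsto_const_nhds h (fun _ => zero_le)
    fun n => ?_
  refine (measure_mono fun ω hω => ?_).trans (measure_union_le _ _)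
  exact not_and_or.1 hω

theorem norm_sub_lt {V : Type*} [NormedAddCommGroup V] {f : ℕ → Ω → V} {g : Ω → V}
    (h : TendstoInMeasure μ f atTop g) {ε : ℝ} (hε : 0 < ε) :
    HoldsWHP μ fun n ω => ‖f n ω - g ω‖ < ε := by
  simpa [HoldsWHP, dist_eq_norm] using tendstoInMeasure_iff_dist.1 h ε hε

end HoldsWHP

theorem tendstoInMeasure_of_holdsWHP {V : Type*} [NormedAddCommGroup V] {f : ℕ → Ω → V} {g : Ω → V}
    (h : ∀ ε > 0, HoldsWHP μ fun n ω => ‖f n ω - g ω‖ < ε) : TendstoInMeasure μ f atTop g := by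
  refine tendstoInMeasure_iff_dist.2 fun ε hε => ?_
  simpa [HoldsWHP, dist_eq_norm] using h ε hε

/-- Weak law of large numbers for functions of independent, identically distributed observations
with values in a finite-dimensional space. -/
theorem holdsWHP_norm_average_sub_lt [IsProbabilityMeasure μ] {𝒴 V : Type*} [MeasurableSpace 𝒴]
    [NormedAddCommGroup V] [NormedSpace ℝ V] [FiniteDimensional ℝ V] [MeasurableSpace V]
    [BorelSpace V] {ν : Measure 𝒴} {Y : ℕ → Ω → 𝒴} (hY : ∀ i, Measurable (Y i))
    (hlaw : ∀ i, μ.map (Y i) = ν) (hind : iIndepFun Y μ) {h : 𝒴 → V} (hm : Measurable h)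
    (hint : Integrable h ν) {ε : ℝ} (hε : 0 < ε) :
    HoldsWHP μ fun n ω => ‖(n : ℝ)⁻¹ • ∑ i ∈ Finset.range n, h (Y i ω) - ∫ y, h y ∂ν‖ < ε := by
  have := FiniteDimensional.proper_real V
  have hmean : ∫ ω, h (Y 0 ω) ∂μ = ∫ y, h y ∂ν := by
    rw [← hlaw 0, integral_map (hY 0).aemeasurable hm.aestronglyMeasurable]
  have hslln := strong_law_ae (μ := μ) (fun i ω => h (Y i ω))
    ((hlaw 0 ▸ hint : Integrable h (μ.map (Y 0))).comp_measurable (hY 0))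
    (fun i j hij => (hind.indepFun hij).comp hm hm)
    (fun i => (IdentDistrib.mk (hY i).aemeasurable (hY 0).aemeasurable
      (by rw [hlaw, hlaw])).comp hm)
  have hslln' := tendstoInMeasure_of_tendsto_ae (fun n =>
    (((Finset.measurable_fun_sum _ fun i _ => hm.comp (hY i)).const_smul
      (n : ℝ)⁻¹).aestronglyMeasurable)) hslln
  simpa [hmean] using HoldsWHP.norm_sub_lt hslln' hε

end WithHighProbability

/-! ### The multivariate central limit theorem -/

section CentralLimit

variable {Ω : Type*} [MeasurableSpace Ω] {μ : Measure Ω} [IsProbabilityMeasure μ]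

/-- The central limit theorem in `ℝ^p`, by the Cramér–Wold device: characteristic functions reduce
it to the real random variables `⟪X i, t⟫`. -/
theorem tendstoInDistribution_multivariateGaussian {p : ℕ}
    {X : ℕ → Ω → EuclideanSpace ℝ (Fin p)} (hX : MemLp (X 0) 2 μ) (hmean : ∫ ω, X 0 ω ∂μ = 0)
    (hind : iIndepFun X μ) (hident : ∀ i, IdentDistrib (X i) (X 0) μ μ)
    {S : Matrix (Fin p) (Fin p) ℝ} (hS : S.PosSemidef)
    (hvar : ∀ t, Var[fun ω => inner ℝ (X 0 ω) t; μ] = t ⬝ᵥ S *ᵥ t) :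
    TendstoInDistribution (fun (n : ℕ) ω => (√(n : ℝ))⁻¹ • ∑ i ∈ Finset.range n, X i ω) atTop id
      (fun _ => μ) (multivariateGaussian 0 S) where
  forall_aemeasurable n := by
    have h := Finset.aemeasurable_fun_sum (Finset.range n) fun i _ => (hident i).aemeasurable_fst
    exact h.const_smul (√(n : ℝ))⁻¹
  aemeasurable_limit := aemeasurable_id
  tendsto := by
    have hm : ∀ n : ℕ, AEMeasurable
        (fun ω => (√(n : ℝ))⁻¹ • ∑ i ∈ Finset.range n, X i ω) μ := fun n => by
      have h := Finset.aemeasurable_fun_sum (Finset.range n) fun i _ => (hident i).aemeasurable_fst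
      exact h.const_smul (√(n : ℝ))⁻¹
    refine ProbabilityMeasure.tendsto_iff_tendsto_charFun.2 fun t => ?_
    have hin : Measurable fun x : EuclideanSpace ℝ (Fin p) => inner ℝ x t := by fun_prop
    set v := Var[fun ω => inner ℝ (X 0 ω) t; μ] with hv
    have hv0 : 0 ≤ v := variance_nonneg _ _
    have h1 : TendstoInDistribution
        (fun (n : ℕ) ω => (√(n : ℝ))⁻¹ * (∑ k ∈ Finset.range n, inner ℝ (X k ω) t -
          n * ∫ ω, inner ℝ (X 0 ω) t ∂μ)) atTop id (fun _ => μ) (gaussianReal 0 v.toNNReal) :=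
      tendstoInDistribution_inv_sqrt_mul_sum_sub (X := fun k ω => inner ℝ (X k ω) t)
        ⟨aemeasurable_id, Measure.map_id⟩ (hX.inner_const t)
        (hind.comp (fun _ x => inner ℝ x t) fun _ => hin) fun i => (hident i).comp hin
    have hmean' : ∫ ω, inner ℝ (X 0 ω) t ∂μ = 0 := by
      have := integral_inner (𝕜 := ℝ) (hX.integrable (by norm_num)) t
      rw [hmean, inner_zero_right] at this
      simpa only [real_inner_comm] using this
    have h2 := ProbabilityMeasure.tendsto_iff_tendsto_charFun.1 h1.tendsto 1
    have hlim : charFun (multivariateGaussian 0 S) t = charFun (gaussianReal 0 v.toNNReal) 1 := by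
      rw [charFun_multivariateGaussian hS, charFun_gaussianReal, ← hvar t]
      simp [Real.coe_toNNReal _ hv0, ← hv]
    change Tendsto _ atTop (𝓝 (charFun (Measure.map id _) 1)) at h2
    change Tendsto _ atTop (𝓝 (charFun (Measure.map id _) t))
    rw [Measure.map_id] at h2 ⊢
    rw [hlim]
    refine h2.congr fun n => ?_
    change charFun (μ.map _) 1 = charFun (μ.map _) t
    rw [charFun_apply, charFun_apply, integral_map (h1.forall_aemeasurable n) (by fun_prop),
      integral_map (hm n) (by fun_prop)]
    simp [hmean', inner_smul_left, sum_inner]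

end CentralLimit

/-! ### Smooth criterion functions and their averages -/

section Measurability

variable {𝒴 E V : Type*} [MeasurableSpace 𝒴] [NormedAddCommGroup E] [InnerProductSpace ℝ E]
  [FiniteDimensional ℝ E] [NormedAddCommGroup V] [NormedSpace ℝ V] [FiniteDimensional ℝ V]
  [MeasurableSpace V] [BorelSpace V] {f : 𝒴 → E → V} {U : Set E} {t : E}

/-- Derivatives in the parameter are limits of difference quotients, so they are measurable in
the observation. Only measurability of `f · s` for `s` near `t` is available, which is why the
difference quotients are taken along a tail. -/
theorem measurable_fderiv_parameter (hU : IsOpen U) (ht : t ∈ U)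
    (hm : ∀ s ∈ U, Measurable fun y => f y s) (hd : ∀ y, DifferentiableAt ℝ (f y) t) :
    Measurable fun y => fderiv ℝ (f y) t := by
  have happ : ∀ v, Measurable fun y => fderiv ℝ (f y) t v := by
    intro v
    have hlim : Tendsto (fun n : ℕ => t + ((n : ℝ))⁻¹ • v) atTop (𝓝 t) := by
      have : Tendsto (fun n : ℕ => t + ((n : ℝ))⁻¹ • v) atTop (𝓝 (t + (0 : ℝ) • v)) :=
        tendsto_const_nhds.add (tendsto_inv_atTop_nhds_zero_nat.smul_const v)
      simpa using this
    obtain ⟨N, hN⟩ := eventually_atTop.1 (hlim.eventually (hU.mem_nhds ht))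
    refine measurable_of_tendsto_metrizable (f := fun (n : ℕ) y =>
      ((n + N : ℕ) : ℝ) • (f y (t + ((n + N : ℕ) : ℝ)⁻¹ • v) - f y t)) (fun n => ?_) ?_
    · exact ((hm _ (hN _ (by omega))).sub (hm t ht)).const_smul _
    · refine tendsto_pi_nhds.2 fun y => ?_
      have hc : Tendsto (fun n : ℕ => ‖(n : ℝ)‖) atTop atTop := by
        simpa using tendsto_natCast_atTop_atTop (R := ℝ)
      exact ((hd y).hasFDerivAt.lim v hc).comp (tendsto_add_atTop_nat N)
  set b := stdOrthonormalBasis ℝ E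
  have hsum : (fun y => fderiv ℝ (f y) t) = fun y =>
      ∑ i, ContinuousLinearMap.smulRightL ℝ E V (innerSL ℝ (b i)) (fderiv ℝ (f y) t (b i)) := by
    funext y
    ext v
    conv_lhs => rw [← b.sum_repr' v, map_sum]
    simp
  rw [hsum]
  exact Finset.measurable_fun_sum _ fun i _ =>
    (ContinuousLinearMap.continuous _).measurable.comp (happ _)

theorem aemeasurable_fderiv_parameter {ν : Measure 𝒴} (hU : IsOpen U) (ht : t ∈ U)
    (hm : ∀ s ∈ U, Measurable fun y => f y s) (hd : ∀ᵐ y ∂ν, DifferentiableAt ℝ (f y) t) :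
    AEMeasurable (fun y => fderiv ℝ (f y) t) ν := by
  classical
  obtain ⟨G, hG, hGm, hGd⟩ := exists_measurable_superset_of_null (ae_iff.1 hd)
  refine ⟨fun y => fderiv ℝ (if y ∈ G then 0 else f y) t, ?_, ?_⟩
  · refine measurable_fderiv_parameter hU ht (fun s hs => ?_) fun y => ?_
    · have : (fun y => (if y ∈ G then 0 else f y) s) = fun y => if y ∈ G then 0 else f y s := by
        funext y; split_ifs <;> rfl
      rw [this]
      exact Measurable.ite hGm measurable_const (hm s hs)
    · split_ifs with hy
      · exact differentiableAt_const 0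
      · exact not_not.1 fun h => hy (hG h)
  · filter_upwards [measure_eq_zero_iff_ae_notMem.1 hGd] with y hy
    simp [hy]

end Measurability

section Modulus

variable {𝒴 E V : Type*} [MeasurableSpace 𝒴] [NormedAddCommGroup E] [NormedSpace ℝ E]
  [FiniteDimensional ℝ E] [NormedAddCommGroup V] [MeasurableSpace V] [BorelSpace V]
  [SecondCountableTopology V]

/-- A dominated family that is continuous in the parameter has, near `θ`, a modulus of continuity
of arbitrarily small expectation. -/
theorem exists_integrable_modulus {ν : Measure 𝒴} {h : 𝒴 → E → V} {U : Set E} {θ : E}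
    (hU : IsOpen U) (hθ : θ ∈ U) (hm : ∀ s ∈ U, Measurable fun y => h y s)
    (hc : ∀ y, ContinuousOn (h y) U) {b : 𝒴 → ℝ} (hb : Integrable b ν)
    (hbound : ∀ y, ∀ s ∈ U, ‖h y s‖ ≤ b y) {ε : ℝ} (hε : 0 < ε) :
    ∃ δ > 0, Metric.ball θ δ ⊆ U ∧ ∃ ρ : 𝒴 → ℝ, Measurable ρ ∧ Integrable ρ ν ∧
      ∫ y, ρ y ∂ν < ε ∧ ∀ y, ∀ s ∈ Metric.ball θ δ, ‖h y s - h y θ‖ ≤ ρ y := by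
  have := FiniteDimensional.proper_real E
  obtain ⟨δ₀, hδ₀, hball⟩ := Metric.isOpen_iff.1 hU θ hθ
  set r : ℕ → ℝ := fun k => δ₀ / ((k : ℝ) + 1) with hr
  have hr0 : ∀ k, 0 < r k := fun k => by positivity
  have hrδ : ∀ k, r k ≤ δ₀ := fun k => div_le_self hδ₀.le (by linarith [k.cast_nonneg (α := ℝ)])
  have hrlim : Tendsto r atTop (𝓝 0) :=
    tendsto_const_nhds.div_atTop (tendsto_natCast_atTop_atTop.atTop_add tendsto_const_nhds)
  have hrU : ∀ k, Metric.ball θ (r k) ⊆ U := fun k => (Metric.ball_subset_ball (hrδ k)).trans hball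
  obtain ⟨D, hDc, hDd⟩ := TopologicalSpace.exists_countable_dense E
  set R : ℕ → 𝒴 → ℝ≥0∞ := fun k y => ⨆ s ∈ Metric.ball θ (r k) ∩ D, ‖h y s - h y θ‖ₑ with hR
  have hRm : ∀ k, Measurable (R k) := fun k =>
    Measurable.biSup _ (hDc.mono Set.inter_subset_right) fun s hs =>
      ((hm s (hrU k hs.1)).sub (hm θ hθ)).enorm
  have hRle : ∀ k y, ∀ s ∈ Metric.ball θ (r k), ‖h y s - h y θ‖ₑ ≤ R k y := by
    intro k y s hs
    have hcl : s ∈ closure (Metric.ball θ (r k) ∩ D) :=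
      hDd.open_subset_closure_inter Metric.isOpen_ball hs
    have hcs : ContinuousWithinAt (fun s => ‖h y s - h y θ‖ₑ) (Metric.ball θ (r k) ∩ D) s :=
      (((hc y).continuousAt (hU.mem_nhds (hrU k hs))).sub
        continuousAt_const).enorm.continuousWithinAt
    have := hcs.mem_closure_image hcl
    refine closure_minimal ?_ isClosed_Iic this
    rintro _ ⟨u, hu, rfl⟩
    exact le_biSup (fun s => ‖h y s - h y θ‖ₑ) hu
  have hRb : ∀ k y, R k y ≤ ENNReal.ofReal (2 * b y) := by
    intro k y
    refine iSup₂_le fun s hs => ?_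
    rw [← ofReal_norm]
    refine ENNReal.ofReal_le_ofReal ((norm_sub_le _ _).trans ?_)
    linarith [hbound y s (hrU k hs.1), hbound y θ hθ]
  have hRlim : ∀ y, Tendsto (fun k => R k y) atTop (𝓝 0) := by
    intro y
    rw [ENNReal.tendsto_nhds_zero]
    intro e he
    have hcθ : Tendsto (fun s => ‖h y s - h y θ‖ₑ) (𝓝 θ) (𝓝 0) := by
      have := (((hc y).continuousAt (hU.mem_nhds hθ)).sub continuousAt_const).enorm.tendsto
        (x := θ) (f := fun s => ‖h y s - h y θ‖ₑ)
      simpa using this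
    obtain ⟨d, hd, hde⟩ := Metric.eventually_nhds_iff.1 ((ENNReal.tendsto_nhds_zero.1 hcθ) e he)
    filter_upwards [hrlim.eventually_lt_const hd] with k hk
    exact iSup₂_le fun s hs => hde ((Metric.mem_ball.1 hs.1).trans hk)
  have hbfin : ∫⁻ y, ENNReal.ofReal (2 * b y) ∂ν ≠ ∞ :=
    (Integrable.lintegral_lt_top (hb.const_mul 2)).ne
  have hlint : Tendsto (fun k => ∫⁻ y, R k y ∂ν) atTop (𝓝 0) := by
    have := tendsto_lintegral_of_dominated_convergence _ hRm
      (fun k => .of_forall fun y => hRb k y) hbfin (.of_forall hRlim)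
    simpa using this
  obtain ⟨k, hk⟩ := (hlint.eventually_lt_const (ENNReal.ofReal_pos.2 hε)).exists
  have hRtop : ∀ y, R k y ≠ ∞ := fun y => ((hRb k y).trans_lt ENNReal.ofReal_lt_top).ne
  have hRint : ∫⁻ y, R k y ∂ν ≠ ∞ := hk.ne_top
  refine ⟨r k, hr0 k, hrU k, fun y => (R k y).toReal, (hRm k).ennreal_toReal,
    integrable_toReal_of_lintegral_ne_top (hRm k).aemeasurable hRint, ?_, fun y s hs => ?_⟩
  · rw [integral_toReal (hRm k).aemeasurable (.of_forall fun y => (hRtop y).lt_top)]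
    exact (ENNReal.lt_ofReal_iff_toReal_lt hRint).1 hk
  · rw [← toReal_enorm]
    exact ENNReal.toReal_mono (hRtop y) (hRle k y s hs)

end Modulus

/-! ### The composite score has mean zero -/

section Marginals

variable {m : ℕ}

/-- A factor that does not depend on the coordinates in `s` can be pulled out of the integral over
these coordinates. -/
theorem lmarginal_mul_left {s : Finset (Fin m)} {c f : (Fin m → ℝ) → ℝ≥0∞} (hf : Measurable f)
    (hc : ∀ x y : Fin m → ℝ, (∀ i ∉ s, x i = y i) → c x = c y) :
    lmarginal (fun _ => (volume : Measure ℝ)) s (fun x => c x * f x) =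
      fun x => c x * lmarginal (fun _ => (volume : Measure ℝ)) s f x := by
  funext x
  have : ∀ y, c (Function.updateFinset x s y) = c x := fun y =>
    hc _ _ fun i hi => by simp [Function.updateFinset, hi]
  simp only [lmarginal, this]
  exact lintegral_const_mul _ (hf.comp measurable_updateFinset)

theorem ennreal_inv_div_mul_le (a b : ℝ≥0∞) : (a / b)⁻¹ * a ≤ b := by
  rcases eq_or_ne b ∞ with rfl | hb
  · exact le_top
  rcases eq_or_ne a 0 with rfl | ha
  · simp
  rcases eq_or_ne a ∞ with rfl | ha'
  · simp [ENNReal.top_div_of_ne_top hb]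
  · rw [ENNReal.inv_div (Or.inl hb) (Or.inr ha), ENNReal.div_mul_cancel ha ha']

theorem ennreal_div_mul_le (a b : ℝ≥0∞) : a / b * b ≤ a := by
  rw [mul_comm]
  exact ENNReal.mul_div_le

end Marginals

namespace CompositeModel

variable {p m K : ℕ} (M : CompositeModel p m K) {θ t : EuclideanSpace ℝ (Fin p)}

theorem measurable_marginal (ht : t ∈ M.Θ) (S : Finset (Fin m)) : Measurable (M.marginal S t) :=
  (M.measurable_f t ht).lmarginal _

theorem measurable_component (ht : t ∈ M.Θ) (k : Fin K) : Measurable (M.component k t) :=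
  ((M.measurable_marginal ht _).div (M.measurable_marginal ht _)).ennreal_toReal

theorem component_nonneg (k : Fin K) (t : EuclideanSpace ℝ (Fin p)) (y : Fin m → ℝ) :
    0 ≤ M.component k t y :=
  ENNReal.toReal_nonneg

theorem measurable_compositeLogDensity (ht : t ∈ M.Θ) : Measurable (M.compositeLogDensity t) :=
  Finset.measurable_fun_sum _ fun k _ =>
    (Real.measurable_log.comp (M.measurable_component ht k)).const_mul _

theorem isProbabilityMeasure_law (ht : t ∈ M.Θ) : IsProbabilityMeasure (M.law t) :=
  ⟨by rw [law, withDensity_apply _ .univ, Measure.restrict_univ, M.lintegral_f t ht]⟩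

theorem marginal_congr {S : Finset (Fin m)} {x y : Fin m → ℝ} (h : ∀ i ∈ S, x i = y i) :
    M.marginal S t x = M.marginal S t y :=
  lmarginal_congr _ _ fun i hi => h i (by simpa using hi)

theorem marginal_eq_lmarginal_marginal (ht : t ∈ M.Θ) {S T : Finset (Fin m)} (hST : S ⊆ T) :
    M.marginal S t = lmarginal (fun _ => (volume : Measure ℝ)) (T \ S) (M.marginal T t) := by
  have hd : Disjoint (T \ S) Tᶜ :=
    Finset.disjoint_left.2 fun i hi hi' => (Finset.mem_compl.1 hi') (Finset.mem_sdiff.1 hi).1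
  have hu : Sᶜ = (T \ S) ∪ Tᶜ := by
    ext i
    have := @hST i
    simp only [Finset.mem_compl, Finset.mem_union, Finset.mem_sdiff]
    tauto
  change lmarginal (fun _ => (volume : Measure ℝ)) Sᶜ (M.f t) = _
  rw [hu, lmarginal_union _ _ (M.measurable_f t ht) hd]
  rfl

/-- The conditional density at `t` relative to the one at `θ` has expectation at most one under
`θ`. Integrating out first the coordinates outside `A ∪ B`, then those in `A`, and last those in
`B`, bounds the integral by that of the marginal density of the coordinates in `B` at `θ`. -/
theorem lintegral_ratio_le_one (k : Fin K) (ht : t ∈ M.Θ) (hθ : θ ∈ M.Θ) :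
    ∫⁻ y, (M.marginal (M.A k ∪ M.B k) t y / M.marginal (M.B k) t y) /
      (M.marginal (M.A k ∪ M.B k) θ y / M.marginal (M.B k) θ y) ∂(M.law θ) ≤ 1 := by
  set S := M.A k ∪ M.B k with hS
  set B := M.B k with hB
  have hBS : B ⊆ S := Finset.subset_union_right
  have m1 := M.measurable_marginal ht S
  have m2 := M.measurable_marginal ht B
  have m3 := M.measurable_marginal hθ S
  have m4 := M.measurable_marginal hθ B
  set c : (Fin m → ℝ) → ℝ≥0∞ := fun y =>
    (M.marginal S t y / M.marginal B t y) / (M.marginal S θ y / M.marginal B θ y) with hc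
  have hcm : Measurable c := (m1.div m2).div (m3.div m4)
  rw [law, lintegral_withDensity_eq_lintegral_mul _ (M.measurable_f θ hθ) hcm]
  have hswap : (M.f θ * c) = fun y => c y * M.f θ y := funext fun y => mul_comm _ _
  rw [hswap]
  have hA : lmarginal (fun _ => (volume : Measure ℝ)) Sᶜ (fun y => c y * M.f θ y) ≤
      fun y => M.marginal B θ y / M.marginal B t y * M.marginal S t y := by
    rw [lmarginal_mul_left (M.measurable_f θ hθ) fun x y hxy => ?_]
    · intro y
      change c y * M.marginal S θ y ≤ _
      calc c y * M.marginal S θ y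
          = M.marginal S t y / M.marginal B t y *
            ((M.marginal S θ y / M.marginal B θ y)⁻¹ * M.marginal S θ y) := by
            simp only [hc]
            rw [div_eq_mul_inv (_ / _), mul_assoc]
        _ ≤ M.marginal S t y / M.marginal B t y * M.marginal B θ y := by
            gcongr; exact ennreal_inv_div_mul_le _ _
        _ = _ := by simp only [div_eq_mul_inv]; ring
    · have h1 : ∀ i ∈ S, x i = y i := fun i hi => hxy i (by simpa using hi)
      have h2 : ∀ i ∈ B, x i = y i := fun i hi => h1 i (hBS hi)
      simp only [hc, M.marginal_congr h1, M.marginal_congr h2]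
  have hB' : lmarginal (fun _ => (volume : Measure ℝ)) Bᶜ (fun y => c y * M.f θ y) ≤
      lmarginal (fun _ => (volume : Measure ℝ)) Bᶜ (M.f θ) := by
    have hd : Disjoint (S \ B) Sᶜ :=
      Finset.disjoint_left.2 fun i hi hi' => (Finset.mem_compl.1 hi') (Finset.mem_sdiff.1 hi).1
    have hu : Bᶜ = (S \ B) ∪ Sᶜ := by
      ext i
      have := @hBS i
      simp only [Finset.mem_compl, Finset.mem_union, Finset.mem_sdiff]
      tauto
    intro x
    calc lmarginal (fun _ => (volume : Measure ℝ)) Bᶜ (fun y => c y * M.f θ y) x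
        = lmarginal (fun _ => volume) (S \ B)
            (lmarginal (fun _ => volume) Sᶜ (fun y => c y * M.f θ y)) x := by
          rw [hu, lmarginal_union _ (fun y => c y * M.f θ y) (hcm.mul (M.measurable_f θ hθ)) hd]
      _ ≤ lmarginal (fun _ => volume) (S \ B)
            (fun y => M.marginal B θ y / M.marginal B t y * M.marginal S t y) x :=
          lmarginal_mono hA x
      _ = M.marginal B θ x / M.marginal B t x * M.marginal B t x := by
          rw [lmarginal_mul_left m1 fun y z hyz => ?_, ← M.marginal_eq_lmarginal_marginal ht hBS]
          have h2 : ∀ i ∈ B, y i = z i := fun i hi => hyz i (by simp [hi])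
          simp only [M.marginal_congr h2]
      _ ≤ M.marginal B θ x := ennreal_div_mul_le _ _
  refine (lintegral_le_of_lmarginal_le Bᶜ (hcm.mul (M.measurable_f θ hθ)) (M.measurable_f θ hθ)
    hB').trans ?_
  exact (M.lintegral_f θ hθ).le

variable {M} {U : Set (EuclideanSpace ℝ (Fin p))}

theorem IsRegularAt.mem_parameter (h : M.IsRegularAt θ U) : θ ∈ M.Θ := h.subset h.mem

theorem IsRegularAt.hasFDerivAt_component (h : M.IsRegularAt θ U) (k : Fin K) :
    ∀ᵐ y ∂(M.law θ), ∀ t ∈ U, HasFDerivAt (fun s => M.component k s y)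
      (M.component k t y • fderiv ℝ (fun s => M.logComponent k s y) t) t := by
  filter_upwards [h.component_pos, h.contDiffOn k] with y hpos hy t ht
  have hd : HasFDerivAt (fun s => M.logComponent k s y)
      (fderiv ℝ (fun s => M.logComponent k s y) t) t :=
    ((hy.differentiableOn (by norm_num)).differentiableAt (h.isOpen.mem_nhds ht)).hasFDerivAt
  have he := hd.exp
  rw [logComponent, Real.exp_log (hpos t (h.subset ht) k)] at he
  refine he.congr_of_eventuallyEq ?_
  filter_upwards [h.isOpen.mem_nhds ht] with s hs
  rw [logComponent, Real.exp_log (hpos s (h.subset hs) k)]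

theorem IsRegularAt.integral_ratio_le_one (h : M.IsRegularAt θ U) (k : Fin K) (ht : t ∈ M.Θ) :
    ∫ y, M.component k t y / M.component k θ y ∂(M.law θ) ≤ 1 := by
  have hθ := h.mem_parameter
  rw [integral_eq_lintegral_of_nonneg_ae
    (.of_forall fun y => div_nonneg (M.component_nonneg k t y) (M.component_nonneg k θ y))
    ((M.measurable_component ht k).div (M.measurable_component hθ k)).aestronglyMeasurable]
  refine ENNReal.toReal_le_of_le_ofReal zero_le_one ?_
  rw [ENNReal.ofReal_one]
  refine le_trans (lintegral_mono fun y => ?_) (M.lintegral_ratio_le_one k ht hθ)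
  rw [component, component, ← ENNReal.toReal_div]
  exact ENNReal.ofReal_toReal_le

/-- The scores of the components have mean zero: the expected density ratio
`t ↦ E_θ[f_k(Y; t) / f_k(Y; θ)]` is at most `1`, with equality at `θ`, so its derivative at `θ`
vanishes, and this derivative is the expected score. -/
theorem IsRegularAt.integrable_fderiv_logComponent (h : M.IsRegularAt θ U) (k : Fin K) :
    Integrable (fun y => fderiv ℝ (fun s => M.logComponent k s y) θ) (M.law θ) ∧
      ∫ y, fderiv ℝ (fun s => M.logComponent k s y) θ ∂(M.law θ) = 0 := by
  have hθ := h.mem_parameter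
  have := M.isProbabilityMeasure_law hθ
  obtain ⟨b, hb, hbound⟩ := h.dominated_deriv k
  set R : EuclideanSpace ℝ (Fin p) → (Fin m → ℝ) → ℝ :=
    fun t y => M.component k t y / M.component k θ y with hR
  have hRm : ∀ t ∈ U, Measurable (R t) := fun t ht =>
    (M.measurable_component (h.subset ht) k).div (M.measurable_component hθ k)
  have hRd : ∀ᵐ y ∂(M.law θ), ∀ t ∈ U, HasFDerivAt (fun s => R s y)
      ((M.component k θ y)⁻¹ • fderiv ℝ (fun s => M.component k s y) t) t := by
    filter_upwards [h.hasFDerivAt_component k] with y hy t ht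
    simpa only [hR, div_eq_inv_mul] using
      ((hy t ht).differentiableAt.hasFDerivAt).const_mul (M.component k θ y)⁻¹
  have hRθ : (fun y => (M.component k θ y)⁻¹ • fderiv ℝ (fun s => M.component k s y) θ)
      =ᵐ[M.law θ] fun y => fderiv ℝ (fun s => M.logComponent k s y) θ := by
    filter_upwards [h.hasFDerivAt_component k, h.component_pos] with y hy hpos
    rw [(hy θ h.mem).fderiv, smul_smul, inv_mul_cancel₀ (hpos θ hθ k).ne', one_smul]
  have hb' : ∀ᵐ y ∂(M.law θ), ∀ t ∈ U,
      ‖(M.component k θ y)⁻¹ • fderiv ℝ (fun s => M.component k s y) t‖ ≤ b y := by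
    filter_upwards [hbound, h.component_pos] with y hy hpos t ht
    have hp := hpos θ hθ k
    rw [norm_smul, norm_inv, Real.norm_of_nonneg hp.le, inv_mul_le_iff₀ hp, mul_comm]
    exact hy t ht
  have hmeas : AEStronglyMeasurable
      (fun y => (M.component k θ y)⁻¹ • fderiv ℝ (fun s => M.component k s y) θ) (M.law θ) := by
    have h1 : AEMeasurable (fun y => fderiv ℝ (fun s => R s y) θ) (M.law θ) :=
      aemeasurable_fderiv_parameter h.isOpen h.mem (f := fun y s => R s y) hRm
        (hRd.mono fun y hy => (hy θ h.mem).differentiableAt)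
    exact (h1.congr (hRd.mono fun y hy => (hy θ h.mem).fderiv)).aestronglyMeasurable
  have hRone : R θ =ᵐ[M.law θ] fun _ => 1 := by
    filter_upwards [h.component_pos] with y hpos
    exact div_self (hpos θ hθ k).ne'
  have hder := hasFDerivAt_integral_of_dominated_of_fderiv_le (h.isOpen.mem_nhds h.mem)
    (F := R) (bound := b) (F' := fun t y =>
      (M.component k θ y)⁻¹ • fderiv ℝ (fun s => M.component k s y) t) (by
      filter_upwards [h.isOpen.mem_nhds h.mem] with t ht
      exact (hRm t ht).aestronglyMeasurable)
    ((integrable_const 1).congr hRone.symm) hmeas hb' hb hRd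
  have hmax : IsLocalMax (fun t => ∫ y, R t y ∂(M.law θ)) θ := by
    filter_upwards [h.isOpen.mem_nhds h.mem] with t ht
    calc ∫ y, R t y ∂(M.law θ) ≤ 1 := h.integral_ratio_le_one k (h.subset ht)
      _ = ∫ y, R θ y ∂(M.law θ) := by rw [integral_congr_ae hRone]; simp
  have hzero : ∫ y, (M.component k θ y)⁻¹ • fderiv ℝ (fun s => M.component k s y) θ ∂(M.law θ)
      = 0 := by
    rw [← hder.fderiv]
    exact hmax.fderiv_eq_zero
  have hint : Integrable
      (fun y => (M.component k θ y)⁻¹ • fderiv ℝ (fun s => M.component k s y) θ) (M.law θ) :=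
    hb.mono' hmeas (hb'.mono fun y hy => hy θ h.mem)
  exact ⟨hint.congr hRθ, by rw [← integral_congr_ae hRθ]; exact hzero⟩

end CompositeModel

/-! ### Local expansion of the average criterion -/

section Criterion

variable {E : Type*} [NormedAddCommGroup E] [InnerProductSpace ℝ E] [FiniteDimensional ℝ E]

/-- The Riesz isomorphism of a real Hilbert space as a linear isometry (Mathlib's
`InnerProductSpace.toDual` is conjugate-linear, which hides linearity over `ℝ`). -/
noncomputable def rieszIsometry (E : Type*) [NormedAddCommGroup E] [InnerProductSpace ℝ E]
    [CompleteSpace E] : (E →L[ℝ] ℝ) →ₗᵢ[ℝ] E where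
  toFun := (InnerProductSpace.toDual ℝ E).symm
  map_add' := map_add _
  map_smul' c x := by simp
  norm_map' x := by simp

theorem gradient_eq_rieszIsometry_comp (f : E → ℝ) :
    gradient f = fun t => rieszIsometry E (fderiv ℝ f t) :=
  rfl

theorem norm_fderiv_gradient (f : E → ℝ) (t : E) (hd : DifferentiableAt ℝ (fderiv ℝ f) t) :
    ‖fderiv ℝ (gradient f) t‖ = ‖iteratedFDeriv ℝ 2 f t‖ := by
  have h : fderiv ℝ (gradient f) t =
      (rieszIsometry E).toContinuousLinearMap.comp (fderiv ℝ (fderiv ℝ f) t) :=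
    ((rieszIsometry E).toContinuousLinearMap.hasFDerivAt.comp t hd.hasFDerivAt).fderiv
  rw [h, LinearIsometry.norm_toContinuousLinearMap_comp, ← norm_iteratedFDeriv_fderiv,
    ← norm_iteratedFDeriv_fderiv, norm_iteratedFDeriv_zero]

theorem ContDiffOn.gradient_of_isOpen {f : E → ℝ} {U : Set E} (hU : IsOpen U)
    (hf : ContDiffOn ℝ 2 f U) : ContDiffOn ℝ 1 (gradient f) U :=
  (rieszIsometry E).toContinuousLinearMap.contDiff.comp_contDiffOn
    (hf.fderiv_of_isOpen hU (by norm_num))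

/-- If the gradient of `f` is close to its linearization with a negative definite `A`, then `f` lies
below a concave parabola touching it at `θ`. -/
theorem sub_le_of_norm_gradient_sub_le {f : E → ℝ} {θ : E} {δ a : ℝ} {A : E →L[ℝ] E}
    (hf : ∀ t ∈ Metric.ball θ δ, DifferentiableAt ℝ f t)
    (hlin : ∀ t ∈ Metric.ball θ δ,
      ‖gradient f t - gradient f θ - A (t - θ)‖ ≤ a / 2 * ‖t - θ‖)
    (hA : ∀ v, inner ℝ (A v) v ≤ -a * ‖v‖ ^ 2) {t : E} (ht : t ∈ Metric.ball θ δ) :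
    f t - f θ ≤ inner ℝ (gradient f θ) (t - θ) - a / 4 * ‖t - θ‖ ^ 2 := by
  set d := t - θ with hd
  have hmem : ∀ τ ∈ Set.Icc (0 : ℝ) 1, θ + τ • d ∈ Metric.ball θ δ := by
    intro τ hτ
    rw [Metric.mem_ball, dist_eq_norm] at ht ⊢
    rw [add_sub_cancel_left, norm_smul, Real.norm_of_nonneg hτ.1]
    exact (mul_le_of_le_one_left (norm_nonneg _) hτ.2).trans_lt ht
  set ψ : ℝ → ℝ := fun τ =>
    f (θ + τ • d) - τ * inner ℝ (gradient f θ) d + a / 4 * τ ^ 2 * ‖d‖ ^ 2 with hψ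
  have hder : ∀ τ ∈ Set.Icc (0 : ℝ) 1, HasDerivAt ψ
      (inner ℝ (gradient f (θ + τ • d)) d - inner ℝ (gradient f θ) d +
        a / 2 * τ * ‖d‖ ^ 2) τ := by
    intro τ hτ
    have h1 : HasDerivAt (fun τ : ℝ => f (θ + τ • d)) (inner ℝ (gradient f (θ + τ • d)) d) τ := by
      have hline : HasDerivAt (fun τ : ℝ => θ + τ • d) d τ := by
        simpa using ((hasDerivAt_id τ).smul_const d).const_add θ
      have := (hf _ (hmem τ hτ)).hasFDerivAt.comp_hasDerivAt τ hline
      rw [inner_gradient_left]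
      exact this
    have h2 : HasDerivAt (fun τ : ℝ => τ * inner ℝ (gradient f θ) d)
        (inner ℝ (gradient f θ) d) τ := by
      simpa using (hasDerivAt_id τ).mul_const (inner ℝ (gradient f θ) d)
    have h3 : HasDerivAt (fun τ : ℝ => a / 4 * τ ^ 2 * ‖d‖ ^ 2) (a / 2 * τ * ‖d‖ ^ 2) τ := by
      have := (((hasDerivAt_id τ).pow 2).const_mul (a / 4)).mul_const (‖d‖ ^ 2)
      refine this.congr_deriv ?_
      simp only [id_eq, Nat.cast_ofNat, Nat.add_one_sub_one, pow_one, mul_one]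
      ring
    exact (h1.sub h2).add h3
  have hanti : AntitoneOn ψ (Set.Icc 0 1) := by
    refine antitoneOn_of_deriv_nonpos (convex_Icc 0 1)
      (fun τ hτ => (hder τ hτ).continuousAt.continuousWithinAt) (fun τ hτ => ?_) fun τ hτ => ?_
    · exact (hder τ (interior_subset hτ)).differentiableAt.differentiableWithinAt
    · replace hτ := interior_subset hτ
      rw [(hder τ hτ).deriv]
      have h1 := hlin _ (hmem τ hτ)
      rw [add_sub_cancel_left, norm_smul, Real.norm_of_nonneg hτ.1] at h1
      have h2 : inner ℝ (gradient f (θ + τ • d) - gradient f θ - A (τ • d)) d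
          ≤ a / 2 * (τ * ‖d‖) * ‖d‖ :=
        (real_inner_le_norm _ _).trans (mul_le_mul_of_nonneg_right h1 (norm_nonneg _))
      rw [inner_sub_left, inner_sub_left, map_smul, inner_smul_left] at h2
      have h3 := mul_le_mul_of_nonneg_left (hA d) hτ.1
      simp only [conj_trivial] at h2
      nlinarith
  have := hanti (Set.left_mem_Icc.2 zero_le_one) (Set.right_mem_Icc.2 zero_le_one) zero_le_one
  simp only [hψ, one_smul, zero_smul, hd, add_sub_cancel, add_zero] at this
  linarith

/-- A criterion function `L y t`, twice continuously differentiable in the parameter `t ∈ U` for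
every observation `y`, measurable in `y`, and with an integrable bound on the Hessians. -/
structure SmoothCriterion {𝒴 : Type*} [MeasurableSpace 𝒴] (ν : Measure 𝒴) (L : 𝒴 → E → ℝ)
    (U : Set E) : Prop where
  isOpen : IsOpen U
  measurable : ∀ t ∈ U, Measurable fun y => L y t
  contDiffOn : ∀ y, ContDiffOn ℝ 2 (L y) U
  dominated : ∃ b : 𝒴 → ℝ, Integrable b ν ∧ ∀ y, ∀ t ∈ U, ‖fderiv ℝ (gradient (L y)) t‖ ≤ b y

namespace SmoothCriterion

variable {𝒴 : Type*} [MeasurableSpace 𝒴] {ν : Measure 𝒴} {L : 𝒴 → E → ℝ} {U : Set E} {θ t : E}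

section Basic

variable (h : SmoothCriterion ν L U)

include h

theorem contDiffAt (y : 𝒴) (ht : t ∈ U) : ContDiffAt ℝ 2 (L y) t :=
  (h.contDiffOn y).contDiffAt (h.isOpen.mem_nhds ht)

theorem differentiableAt (y : 𝒴) (ht : t ∈ U) : DifferentiableAt ℝ (L y) t :=
  (h.contDiffAt y ht).differentiableAt (by norm_num)

theorem differentiableAt_gradient (y : 𝒴) (ht : t ∈ U) : DifferentiableAt ℝ (gradient (L y)) t :=
  (((h.contDiffOn y).gradient_of_isOpen h.isOpen).contDiffAt
    (h.isOpen.mem_nhds ht)).differentiableAt (by norm_num)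

theorem continuousOn_hessian (y : 𝒴) : ContinuousOn (fderiv ℝ (gradient (L y))) U :=
  ((h.contDiffOn y).gradient_of_isOpen h.isOpen).continuousOn_fderiv_of_isOpen h.isOpen le_rfl

theorem gradient_sum {ι : Type*} (s : Finset ι) (x : ι → 𝒴) (ht : t ∈ U) :
    gradient (fun t => ∑ i ∈ s, L (x i) t) t = ∑ i ∈ s, gradient (L (x i)) t := by
  simp only [gradient_eq_rieszIsometry_comp]
  rw [fderiv_fun_sum fun i _ => h.differentiableAt (x i) ht, map_sum]

theorem contDiffAt_sum {ι : Type*} (s : Finset ι) (x : ι → 𝒴) (ht : t ∈ U) :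
    ContDiffAt ℝ 2 (fun t => ∑ i ∈ s, L (x i) t) t :=
  ContDiffAt.sum fun i _ => h.contDiffAt (x i) ht

end Basic

variable [MeasurableSpace E] [BorelSpace E]

theorem measurable_gradient (h : SmoothCriterion ν L U) (ht : t ∈ U) :
    Measurable fun y => gradient (L y) t :=
  (rieszIsometry E).continuous.measurable.comp
    (measurable_fderiv_parameter h.isOpen ht h.measurable fun y => h.differentiableAt y ht)

theorem measurable_hessian (h : SmoothCriterion ν L U) (ht : t ∈ U) :
    Measurable fun y => fderiv ℝ (gradient (L y)) t :=
  measurable_fderiv_parameter h.isOpen ht (fun _ hs => h.measurable_gradient hs)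
    fun y => h.differentiableAt_gradient y ht

variable {Ω : Type*} [MeasurableSpace Ω] {μ : Measure Ω} [IsProbabilityMeasure μ]
  {Y : ℕ → Ω → 𝒴}

/-- Uniform law of large numbers for the Hessians near `θ`. -/
theorem exists_holdsWHP_norm_average_hessian_sub_le (h : SmoothCriterion ν L U) (hθ : θ ∈ U)
    (hY : ∀ i, Measurable (Y i)) (hlaw : ∀ i, μ.map (Y i) = ν) (hind : iIndepFun Y μ)
    {ε : ℝ} (hε : 0 < ε) :
    ∃ δ > 0, Metric.ball θ δ ⊆ U ∧ HoldsWHP μ fun n ω => ∀ t ∈ Metric.ball θ δ,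
      ‖(n : ℝ)⁻¹ • ∑ i ∈ Finset.range n, fderiv ℝ (gradient (L (Y i ω))) t -
        ∫ y, fderiv ℝ (gradient (L y)) θ ∂ν‖ ≤ ε := by
  obtain ⟨b, hb, hbound⟩ := h.dominated
  obtain ⟨δ, hδ, hball, ρ, hρm, hρi, hρlt, hρ⟩ := exists_integrable_modulus h.isOpen hθ
    (h := fun y t => fderiv ℝ (gradient (L y)) t) (fun s hs => h.measurable_hessian hs)
    h.continuousOn_hessian hb hbound (ε := ε / 3) (by positivity)
  have hint : Integrable (fun y => fderiv ℝ (gradient (L y)) θ) ν :=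
    hb.mono' (h.measurable_hessian hθ).aestronglyMeasurable (.of_forall fun y => hbound y θ hθ)
  have h1 := holdsWHP_norm_average_sub_lt hY hlaw hind (h.measurable_hessian hθ) hint
    (ε := ε / 3) (by positivity)
  have h2 := holdsWHP_norm_average_sub_lt hY hlaw hind hρm hρi (ε := ε / 3) (by positivity)
  refine ⟨δ, hδ, hball, (h1.and h2).mono (.of_forall fun n => .of_forall ?_)⟩
  rintro ω ⟨g1, g2⟩ t ht
  set B := ∫ y, fderiv ℝ (gradient (L y)) θ ∂ν
  have g3 : ‖(n : ℝ)⁻¹ • ∑ i ∈ Finset.range n, fderiv ℝ (gradient (L (Y i ω))) t -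
      (n : ℝ)⁻¹ • ∑ i ∈ Finset.range n, fderiv ℝ (gradient (L (Y i ω))) θ‖ ≤
      (n : ℝ)⁻¹ • ∑ i ∈ Finset.range n, ρ (Y i ω) := by
    rw [← smul_sub, ← Finset.sum_sub_distrib, norm_smul, Real.norm_of_nonneg (by positivity),
      smul_eq_mul]
    gcongr
    exact norm_sum_le_of_le _ fun i _ => hρ (Y i ω) t ht
  have g4 := (abs_lt.1 ((Real.norm_eq_abs _).symm.trans_lt g2)).2
  have g5 := norm_sub_le_norm_sub_add_norm_sub
    ((n : ℝ)⁻¹ • ∑ i ∈ Finset.range n, fderiv ℝ (gradient (L (Y i ω))) t)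
    ((n : ℝ)⁻¹ • ∑ i ∈ Finset.range n, fderiv ℝ (gradient (L (Y i ω))) θ) B
  linarith

/-- The average score is, with probability tending to one and uniformly near `θ`, linear up to an
arbitrarily small relative error. -/
theorem exists_holdsWHP_norm_average_gradient_sub_le (h : SmoothCriterion ν L U) (hθ : θ ∈ U)
    (hY : ∀ i, Measurable (Y i)) (hlaw : ∀ i, μ.map (Y i) = ν) (hind : iIndepFun Y μ)
    {ε : ℝ} (hε : 0 < ε) :
    ∃ δ > 0, Metric.ball θ δ ⊆ U ∧ HoldsWHP μ fun n ω => ∀ t ∈ Metric.ball θ δ,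
      ‖(n : ℝ)⁻¹ • ∑ i ∈ Finset.range n, gradient (L (Y i ω)) t -
        (n : ℝ)⁻¹ • ∑ i ∈ Finset.range n, gradient (L (Y i ω)) θ -
        (∫ y, fderiv ℝ (gradient (L y)) θ ∂ν) (t - θ)‖ ≤ ε * ‖t - θ‖ := by
  obtain ⟨δ, hδ, hball, hw⟩ :=
    h.exists_holdsWHP_norm_average_hessian_sub_le hθ hY hlaw hind hε
  refine ⟨δ, hδ, hball, hw.mono (.of_forall fun n => .of_forall fun ω hω t ht => ?_)⟩
  set B := ∫ y, fderiv ℝ (gradient (L y)) θ ∂ν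
  have hder : ∀ s ∈ Metric.ball θ δ, HasFDerivWithinAt
      (fun s => (n : ℝ)⁻¹ • ∑ i ∈ Finset.range n, gradient (L (Y i ω)) s)
      ((n : ℝ)⁻¹ • ∑ i ∈ Finset.range n, fderiv ℝ (gradient (L (Y i ω))) s)
      (Metric.ball θ δ) s := fun s hs =>
    ((HasFDerivAt.fun_sum fun i _ =>
      (h.differentiableAt_gradient (Y i ω) (hball hs)).hasFDerivAt).const_smul
        (n : ℝ)⁻¹).hasFDerivWithinAt
  exact (convex_ball θ δ).norm_image_sub_le_of_norm_hasFDerivWithin_le' hder hω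
    (Metric.mem_ball_self hδ) ht

end SmoothCriterion

end Criterion

/-! ### Asymptotic linearity and existence of restricted estimators -/

section Tightness

variable {Ω E : Type*} [MeasurableSpace Ω] {μ : Measure Ω} [IsProbabilityMeasure μ]
  [NormedAddCommGroup E] [MeasurableSpace E] [BorelSpace E]

theorem exists_eventually_measure_norm_ge_le {Ω' : Type*} [MeasurableSpace Ω'] {μ' : Measure Ω'}
    [IsProbabilityMeasure μ'] {Z : ℕ → Ω → E} {W : Ω' → E}
    (h : TendstoInDistribution Z atTop W (fun _ => μ) μ') {η : ℝ≥0∞} (hη : 0 < η) :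
    ∃ R > 0, ∀ᶠ n in atTop, μ {ω | R ≤ ‖Z n ω‖} ≤ η := by
  set F : ℕ → Set E := fun k => {x | (k : ℝ) + 1 ≤ ‖x‖} with hF
  have hFc : ∀ k, IsClosed (F k) := fun k => isClosed_le continuous_const continuous_norm
  have hanti : Antitone F := fun k l hkl x hx => by
    have : (k : ℝ) ≤ l := by exact_mod_cast hkl
    exact le_trans (by linarith) (show (l : ℝ) + 1 ≤ ‖x‖ from hx)
  have hempty : ⋂ k, F k = ∅ := by
    refine Set.eq_empty_of_forall_notMem fun x hx => ?_
    obtain ⟨k, hk⟩ := exists_nat_gt ‖x‖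
    have : (k : ℝ) + 1 ≤ ‖x‖ := Set.mem_iInter.1 hx k
    linarith
  have hlim := tendsto_measure_iInter_atTop (μ := μ'.map W)
    (fun k => (hFc k).measurableSet.nullMeasurableSet) hanti ⟨0, by
      have := Measure.isProbabilityMeasure_map h.aemeasurable_limit
      exact measure_ne_top _ _⟩
  rw [hempty, measure_empty] at hlim
  obtain ⟨k, hk⟩ := (hlim.eventually_lt_const hη).exists
  refine ⟨(k : ℝ) + 1, by positivity, ?_⟩
  have hls := (ProbabilityMeasure.limsup_measure_closed_le_of_tendsto h.tendsto (hFc k)).trans_lt hk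
  filter_upwards [eventually_lt_of_limsup_lt hls] with n hn
  have e : (μ.map (Z n)) (F k) = μ {ω | (k : ℝ) + 1 ≤ ‖Z n ω‖} :=
    Measure.map_apply_of_aemeasurable (h.forall_aemeasurable n) (hFc k).measurableSet
  rw [← e]
  exact hn.le

end Tightness

section Existence

variable {E F : Type*} [NormedAddCommGroup E] [InnerProductSpace ℝ E] [FiniteDimensional ℝ E]
  [NormedAddCommGroup F] [NormedSpace ℝ F] [MeasurableSpace E] [BorelSpace E]
  {𝒴 Ω : Type*} [MeasurableSpace 𝒴] {ν : Measure 𝒴} {L : 𝒴 → E → ℝ} {U : Set E} {θ : E}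
  [MeasurableSpace Ω] {μ : Measure Ω} [IsProbabilityMeasure μ] {Y : ℕ → Ω → 𝒴} {g : E → F}

/-- Existence of consistent local maximizers. The estimator is a measurable maximizer of the
criterion over the constraint set within a fixed small closed ball around `θ`; the negative definite
mean Hessian forces it into the interior of the ball, and towards `θ`. -/
theorem exists_measurable_consistent_local_maximizer (h : SmoothCriterion ν L U) (hθ : θ ∈ U)
    (hY : ∀ i, Measurable (Y i)) (hlaw : ∀ i, μ.map (Y i) = ν) (hind : iIndepFun Y μ)
    (hdiff : ∀ t ∈ U, DifferentiableAt ℝ g t) (hgθ : g θ = 0) {a : ℝ} (ha : 0 < a)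
    (hneg : ∀ v, inner ℝ ((∫ y, fderiv ℝ (gradient (L y)) θ ∂ν) v) v ≤ -a * ‖v‖ ^ 2)
    (hint : Integrable (fun y => gradient (L y) θ) ν) (hmean : ∫ y, gradient (L y) θ ∂ν = 0) :
    ∃ T : (n : ℕ) → (Fin n → 𝒴) → E, (∀ n, Measurable (T n)) ∧
      TendstoInMeasure μ (fun n ω => T n fun i : Fin n => Y i ω) atTop (fun _ => θ) ∧
      HoldsWHP μ fun n ω => g (T n fun i : Fin n => Y i ω) = 0 ∧
        IsLocalMaxOn (fun t => ∑ i : Fin n, L (Y i ω) t) {t | g t = 0}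
          (T n fun i : Fin n => Y i ω) := by
  have := FiniteDimensional.proper_real E
  obtain ⟨δ, hδ, hball, hw⟩ :=
    h.exists_holdsWHP_norm_average_gradient_sub_le hθ hY hlaw hind (half_pos ha)
  set r := δ / 2 with hr
  have hr0 : 0 < r := half_pos hδ
  have hrδ : Metric.closedBall θ r ⊆ Metric.ball θ δ := Metric.closedBall_subset_ball (by linarith)
  set C : Set E := Metric.closedBall θ r ∩ g ⁻¹' {0} with hC
  have hCU : C ⊆ U := Set.inter_subset_left.trans (hrδ.trans hball)
  have hCc : IsCompact C := by
    refine (isCompact_closedBall θ r).of_isClosed_subset ?_ Set.inter_subset_left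
    refine ContinuousOn.preimage_isClosed_of_isClosed (fun t ht => ?_) Metric.isClosed_closedBall
      isClosed_singleton
    exact (hdiff t (hball (hrδ ht))).continuousAt.continuousWithinAt
  have hθC : θ ∈ C := ⟨Metric.mem_closedBall_self hr0.le, hgθ⟩
  have : CompactSpace C := isCompact_iff_compactSpace.1 hCc
  have : Nonempty C := ⟨⟨θ, hθC⟩⟩
  have hex : ∀ n : ℕ, ∃ T : (Fin n → 𝒴) → C, Measurable T ∧
      ∀ (x : Fin n → 𝒴) (s : C), ∑ i, L (x i) (s : E) ≤ ∑ i, L (x i) (T x : E) := fun n =>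
    exists_measurable_maximizer (F := fun (x : Fin n → 𝒴) (t : C) => ∑ i, L (x i) (t : E))
      (fun t => Finset.measurable_fun_sum _ fun i _ =>
        (h.measurable t (hCU t.2)).comp (measurable_pi_apply i))
      (fun x => continuous_finsetSum _ fun i _ =>
        continuousOn_iff_continuous_domRestrict.1 ((h.contDiffOn (x i)).continuousOn.mono hCU))
  choose T hTm hTmax using hex
  -- the parabola bound turns the maximum property into a bound by the average score at `θ`
  have hbound : HoldsWHP μ fun n ω => ‖((T n fun i : Fin n => Y i ω : C) : E) - θ‖ ≤
      4 / a * ‖(n : ℝ)⁻¹ • ∑ i ∈ Finset.range n, gradient (L (Y i ω)) θ‖ := by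
    refine hw.mono ((eventually_gt_atTop 0).mono fun n hn => .of_forall fun ω hω => ?_)
    set t : C := T n fun i : Fin n => Y i ω with ht
    have htb : (t : E) ∈ Metric.ball θ δ := hrδ t.2.1
    set f : E → ℝ := fun s => (n : ℝ)⁻¹ * ∑ i ∈ Finset.range n, L (Y i ω) s with hf
    have hgrad : ∀ s ∈ Metric.ball θ δ,
        gradient f s = (n : ℝ)⁻¹ • ∑ i ∈ Finset.range n, gradient (L (Y i ω)) s := by
      intro s hs
      rw [← h.gradient_sum (Finset.range n) (fun i => Y i ω) (hball hs)]
      simp only [gradient_eq_rieszIsometry_comp, hf]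
      rw [fderiv_const_mul ((h.contDiffAt_sum _ _ (hball hs)).differentiableAt (by norm_num)),
        map_smul]
    have hθb := Metric.mem_ball_self (x := θ) hδ
    have hpar := sub_le_of_norm_gradient_sub_le (f := f) (θ := θ) (δ := δ) (a := a)
      (fun s hs => ((h.contDiffAt_sum _ _ (hball hs)).differentiableAt
        (by norm_num)).const_mul _)
      (fun s hs => by rw [hgrad s hs, hgrad θ hθb]; exact hω s hs) hneg htb
    rw [hgrad θ hθb] at hpar
    have hmax : f θ ≤ f t := by
      have := hTmax n (fun i : Fin n => Y i ω) ⟨θ, hθC⟩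
      simp only [hf, Finset.sum_range]
      exact mul_le_mul_of_nonneg_left this (by positivity)
    set s := (n : ℝ)⁻¹ • ∑ i ∈ Finset.range n, gradient (L (Y i ω)) θ
    have hcs := real_inner_le_norm s ((t : E) - θ)
    have hq : a / 4 * ‖(t : E) - θ‖ ^ 2 ≤ ‖s‖ * ‖(t : E) - θ‖ := by linarith
    rcases (norm_nonneg ((t : E) - θ)).eq_or_lt with h0 | h0
    · rw [← h0]; positivity
    · have h1 : a / 4 * ‖(t : E) - θ‖ ≤ ‖s‖ := by
        refine le_of_mul_le_mul_right ?_ h0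
        linarith [hq, sq ‖(t : E) - θ‖]
      rw [div_mul_eq_mul_div, le_div_iff₀ ha]
      linarith
  have hclose : ∀ ε > 0, HoldsWHP μ fun n ω =>
      ‖((T n fun i : Fin n => Y i ω : C) : E) - θ‖ < ε := by
    intro ε hε
    have hs := holdsWHP_norm_average_sub_lt hY hlaw hind (h.measurable_gradient hθ) hint
      (ε := a / 4 * ε) (by positivity)
    refine (hbound.and hs).mono (.of_forall fun n => .of_forall ?_)
    rintro ω ⟨g1, g2⟩
    rw [hmean, sub_zero] at g2
    calc _ ≤ _ := g1
      _ < 4 / a * (a / 4 * ε) := by gcongr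
      _ = ε := by field_simp
  refine ⟨fun n x => T n x, fun n => measurable_subtype_coe.comp (hTm n),
    tendstoInMeasure_of_holdsWHP hclose, (hclose r hr0).mono
      (.of_forall fun n => .of_forall fun ω hω => ⟨(T n _).2.2, ?_⟩)⟩
  have hnear : Metric.ball θ r ∈ 𝓝 ((T n fun i : Fin n => Y i ω : C) : E) :=
    Metric.isOpen_ball.mem_nhds (by rwa [Metric.mem_ball, dist_eq_norm])
  filter_upwards [mem_nhdsWithin_of_mem_nhds hnear, self_mem_nhdsWithin] with t ht hgt
  exact hTmax n _ ⟨t, Metric.ball_subset_closedBall ht, hgt⟩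

end Existence

section Restricted

variable {E F : Type*} [NormedAddCommGroup E] [InnerProductSpace ℝ E] [FiniteDimensional ℝ E]
  [NormedAddCommGroup F] [InnerProductSpace ℝ F] [FiniteDimensional ℝ F]
  {𝒴 Ω : Type*} [MeasurableSpace 𝒴] {ν : Measure 𝒴} {L : 𝒴 → E → ℝ} {U : Set E} {θ : E}
  [MeasurableSpace Ω] {μ : Measure Ω} [IsProbabilityMeasure μ] {Y : ℕ → Ω → 𝒴} {g : E → F}

open ContinuousLinearMap (adjoint)

/-- Near a regular point of a continuously differentiable constraint every local maximizer on the
constraint set has a multiplier. -/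
theorem eventually_exists_multiplier (hU : U ∈ 𝓝 θ) (hUo : IsOpen U)
    (hdiff : ∀ t ∈ U, DifferentiableAt ℝ g t) (hcont : ContinuousOn (fderiv ℝ g) U)
    (hD : Function.Surjective (fderiv ℝ g θ)) :
    ∀ᶠ t in 𝓝 θ, ∀ φ : E → ℝ, ContDiffAt ℝ 2 φ t → g t = 0 → IsLocalMaxOn φ {x | g x = 0} t →
      ∃ l : F, gradient φ t + adjoint (fderiv ℝ g t) l = 0 := by
  obtain ⟨κ, hκ, hev⟩ := eventually_norm_le_mul_norm_adjoint (hcont.continuousAt hU) hD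
  filter_upwards [hev, hU] with t ht htU φ hφ hgt hmax
  have htU' : U ∈ 𝓝 t := hUo.mem_nhds htU
  refine exists_gradient_add_adjoint_eq_zero (by rwa [hgt]) ?_
    (hφ.hasStrictFDerivAt (by norm_num)) fun l hl => ?_
  · exact hasStrictFDerivAt_of_hasFDerivAt_of_continuousAt
      (by filter_upwards [htU'] with s hs using (hdiff s hs).hasFDerivAt)
      (hcont.continuousAt htU')
  · have := ht l
    rw [hl, norm_zero, mul_zero] at this
    exact norm_le_zero_iff.1 this

variable [MeasurableSpace E] [BorelSpace E]

/-- Asymptotic linearity: a consistent sequence of solutions of the restricted equations satisfies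
`√n (θ̃ - θ) = P (n^{-1/2} ∑ᵢ u(θ, Yᵢ)) + o_p(1)`. -/
theorem tendstoInMeasure_restricted_sub (h : SmoothCriterion ν L U) (hθ : θ ∈ U)
    (hY : ∀ i, Measurable (Y i)) (hlaw : ∀ i, μ.map (Y i) = ν) (hind : iIndepFun Y μ)
    (hdiff : ∀ t ∈ U, DifferentiableAt ℝ g t) (hcont : ContinuousOn (fderiv ℝ g) U)
    (hD : Function.Surjective (fderiv ℝ g θ)) (hgθ : g θ = 0)
    {H P : E →L[ℝ] E} {Q : F →L[ℝ] E} (hH : ∫ y, fderiv ℝ (gradient (L y)) θ ∂ν = -H)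
    (hPH : ∀ v, P (H v) = v + Q (fderiv ℝ g θ v))
    (hPD : ∀ l, P (adjoint (fderiv ℝ g θ) l) = 0)
    (htight : ∀ η : ℝ≥0∞, 0 < η → ∃ R > 0, ∀ᶠ n : ℕ in atTop,
      μ {ω | R ≤ ‖(√(n : ℝ))⁻¹ • ∑ i ∈ Finset.range n, gradient (L (Y i ω)) θ‖} ≤ η)
    {T : ℕ → Ω → E} (hT : TendstoInMeasure μ T atTop fun _ => θ)
    (hsol : HoldsWHP μ fun n ω => g (T n ω) = 0 ∧ ∃ l, ∑ i ∈ Finset.range n,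
      gradient (L (Y i ω)) (T n ω) + adjoint (fderiv ℝ g (T n ω)) l = 0) :
    TendstoInMeasure μ (fun (n : ℕ) ω => √(n : ℝ) • (T n ω - θ) -
      P ((√(n : ℝ))⁻¹ • ∑ i ∈ Finset.range n, gradient (L (Y i ω)) θ)) atTop 0 := by
  have hUθ := h.isOpen.mem_nhds hθ
  have hlin : ∀ ε > 0, HoldsWHP μ fun n ω =>
      ‖T n ω - θ - P ((n : ℝ)⁻¹ • ∑ i ∈ Finset.range n, gradient (L (Y i ω)) θ)‖ ≤
        ε * ‖(n : ℝ)⁻¹ • ∑ i ∈ Finset.range n, gradient (L (Y i ω)) θ‖ := by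
    intro ε hε
    obtain ⟨δ, hδ, hcore⟩ := exists_norm_sub_le_of_restricted_equation (hdiff θ hθ)
      (hcont.continuousAt hUθ) hD hgθ H P Q hPH hPD hε
    obtain ⟨δ', hδ', -, hw⟩ :=
      h.exists_holdsWHP_norm_average_gradient_sub_le hθ hY hlaw hind hδ
    have hclose := HoldsWHP.norm_sub_lt hT (lt_min hδ hδ')
    refine ((hw.and hclose).and hsol).mono (.of_forall fun n => .of_forall ?_)
    rintro ω ⟨⟨g1, g2⟩, g3, l, g4⟩
    refine hcore _ (g2.trans_le (min_le_left _ _)) g3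
      ((n : ℝ)⁻¹ • ∑ i ∈ Finset.range n, gradient (L (Y i ω)) (T n ω)) _ ((n : ℝ)⁻¹ • l) ?_ ?_
    · rw [map_smul, ← smul_add, g4, smul_zero]
    · have := g1 (T n ω) (by
        rw [Metric.mem_ball, dist_eq_norm]; exact g2.trans_le (min_le_right _ _))
      rwa [hH, neg_apply, sub_neg_eq_add] at this
  refine tendstoInMeasure_of_holdsWHP fun ε hε => ?_
  refine ENNReal.tendsto_nhds_zero.2 fun η hη => ?_
  obtain ⟨R, hR, hRev⟩ := htight (η / 2) (ENNReal.half_pos hη.ne')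
  have hlinR := ENNReal.tendsto_nhds_zero.1 (hlin (ε / R) (by positivity)) (η / 2)
    (ENNReal.half_pos hη.ne')
  filter_upwards [hRev, hlinR] with n h1 h2
  calc _ ≤ μ ({ω | R ≤ ‖(√(n : ℝ))⁻¹ • ∑ i ∈ Finset.range n, gradient (L (Y i ω)) θ‖} ∪
        {ω | ¬ ‖T n ω - θ - P ((n : ℝ)⁻¹ • ∑ i ∈ Finset.range n, gradient (L (Y i ω)) θ)‖ ≤
          ε / R * ‖(n : ℝ)⁻¹ • ∑ i ∈ Finset.range n, gradient (L (Y i ω)) θ‖}) := by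
        refine measure_mono fun ω hω => ?_
        by_contra hcon
        rw [Set.mem_union, not_or] at hcon
        obtain ⟨c1, c2⟩ := hcon
        rw [Set.mem_ofPred_eq, not_le] at c1
        replace c2 := not_not.1 c2
        refine hω ?_
        have hsq : (√(n : ℝ))⁻¹ = √(n : ℝ) * (n : ℝ)⁻¹ := by
          rcases eq_or_ne (n : ℝ) 0 with h0 | h0
          · simp [h0]
          · have := Real.mul_self_sqrt (n.cast_nonneg (α := ℝ))
            have h0' : √(n : ℝ) ≠ 0 := by positivity
            field_simp
            linarith
        rw [hsq, mul_smul] at c1 ⊢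
        rw [norm_smul, Real.norm_of_nonneg (Real.sqrt_nonneg _)] at c1
        rw [map_smul, ← smul_sub, Pi.zero_apply, sub_zero, norm_smul,
          Real.norm_of_nonneg (Real.sqrt_nonneg _)]
        calc _ ≤ √(n : ℝ) * (ε / R *
              ‖(n : ℝ)⁻¹ • ∑ i ∈ Finset.range n, gradient (L (Y i ω)) θ‖) := by gcongr
          _ = ε / R * (√(n : ℝ) *
              ‖(n : ℝ)⁻¹ • ∑ i ∈ Finset.range n, gradient (L (Y i ω)) θ‖) := by ring
          _ < ε / R * R := by gcongr
          _ = ε := by field_simp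
    _ ≤ η / 2 + η / 2 := (measure_union_le _ _).trans (add_le_add h1 h2)
    _ = η := ENNReal.add_halves η

end Restricted

/-! ### Matrices and linear maps -/

section Matrices

variable {p r : ℕ} {g : EuclideanSpace ℝ (Fin p) → EuclideanSpace ℝ (Fin r)}
  {t : EuclideanSpace ℝ (Fin p)}

open ContinuousLinearMap (adjoint)
open CompositeModel (constraintJacobian)

theorem fderiv_eq_constraintJacobian :
    fderiv ℝ g t = (Matrix.toEuclideanLin (constraintJacobian g t)ᵀ).toContinuousLinearMap := by
  ext v j
  have hv : v = ∑ i, v i • EuclideanSpace.single i (1 : ℝ) := by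
    simpa using ((EuclideanSpace.basisFun (Fin p) ℝ).sum_repr v).symm
  conv_lhs => rw [hv, map_sum]
  simp [Matrix.mulVec, dotProduct, constraintJacobian, mul_comm]

theorem fderiv_apply_constraintJacobian (v : EuclideanSpace ℝ (Fin p)) :
    fderiv ℝ g t v = WithLp.toLp 2 ((constraintJacobian g t)ᵀ *ᵥ v) := by
  rw [fderiv_eq_constraintJacobian]; rfl

theorem adjoint_fderiv_apply (l : EuclideanSpace ℝ (Fin r)) :
    adjoint (fderiv ℝ g t) l = WithLp.toLp 2 (constraintJacobian g t *ᵥ l) := by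
  ext a
  have h1 : (adjoint (fderiv ℝ g t) l) a =
      inner ℝ (EuclideanSpace.single a (1 : ℝ)) (adjoint (fderiv ℝ g t) l) := by
    simp [EuclideanSpace.inner_single_left]
  rw [h1, ContinuousLinearMap.adjoint_inner_right, PiLp.inner_apply]
  simp [Matrix.mulVec, dotProduct, constraintJacobian, mul_comm]

theorem continuousOn_fderiv_of_constraintJacobian {U : Set (EuclideanSpace ℝ (Fin p))}
    (h : ContinuousOn (constraintJacobian g) U) : ContinuousOn (fderiv ℝ g) U := by
  let Φ : Matrix (Fin p) (Fin r) ℝ →ₗ[ℝ]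
      (EuclideanSpace ℝ (Fin p) →L[ℝ] EuclideanSpace ℝ (Fin r)) :=
    LinearMap.toContinuousLinearMap.toLinearMap ∘ₗ Matrix.toEuclideanLin.toLinearMap ∘ₗ
      (Matrix.transposeLinearEquiv (Fin p) (Fin r) ℝ ℝ).toLinearMap
  have hΦ : Continuous Φ := Φ.continuous_of_finiteDimensional
  exact (hΦ.comp_continuousOn h).congr fun t _ => fderiv_eq_constraintJacobian

theorem surjective_fderiv_of_rank (h : (constraintJacobian g t).rank = r) :
    Function.Surjective (fderiv ℝ g t) := by
  have htop : LinearMap.range (constraintJacobian g t)ᵀ.mulVecLin = ⊤ := by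
    refine Submodule.eq_top_of_finrank_eq ?_
    have := Matrix.rank_transpose (constraintJacobian g t)
    rw [Matrix.rank, h] at this
    rw [this, Module.finrank_fin_fun]
  intro y
  obtain ⟨x, hx⟩ := LinearMap.range_eq_top.1 htop y.ofLp
  refine ⟨WithLp.toLp 2 x, ?_⟩
  rw [fderiv_apply_constraintJacobian]
  exact congrArg (WithLp.toLp 2) hx

theorem mulVec_injective_of_rank {G : Matrix (Fin p) (Fin r) ℝ} (h : G.rank = r) :
    Function.Injective G.mulVec := by
  rw [Matrix.mulVec_injective_iff, linearIndependent_iff_card_eq_finrank_span, Fintype.card_fin]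
  rw [Matrix.rank_eq_finrank_span_cols] at h
  exact h.symm

theorem exists_pos_le_inner_toEuclideanCLM {H : Matrix (Fin p) (Fin p) ℝ} (hH : H.PosDef) :
    ∃ a > 0, ∀ v : EuclideanSpace ℝ (Fin p),
      a * ‖v‖ ^ 2 ≤ inner ℝ (Matrix.toEuclideanCLM (𝕜 := ℝ) H v) v := by
  have hpos : ∀ v : EuclideanSpace ℝ (Fin p), v ≠ 0 →
      0 < inner ℝ (Matrix.toEuclideanCLM (𝕜 := ℝ) H v) v := fun v hv => by
    rw [real_inner_comm, Matrix.inner_toEuclideanCLM]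
    have := hH.dotProduct_mulVec_pos (x := v.ofLp) (by simpa using hv)
    simpa using this
  rcases (Metric.sphere (0 : EuclideanSpace ℝ (Fin p)) 1).eq_empty_or_nonempty with he | hne
  · refine ⟨1, one_pos, fun v => ?_⟩
    rcases eq_or_ne v 0 with rfl | hv
    · simp
    · have : ‖v‖⁻¹ • v ∈ Metric.sphere (0 : EuclideanSpace ℝ (Fin p)) 1 := by
        simp [norm_smul, inv_mul_cancel₀ (norm_ne_zero_iff.2 hv)]
      rw [he] at this
      exact this.elim
  · obtain ⟨x, hx, hmin⟩ := (isCompact_sphere (0 : EuclideanSpace ℝ (Fin p)) 1).exists_isMinOn hne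
      (f := fun v => inner ℝ (Matrix.toEuclideanCLM (𝕜 := ℝ) H v) v) (by fun_prop)
    refine ⟨_, hpos x (by rintro rfl; simp at hx), fun v => ?_⟩
    rcases eq_or_ne v 0 with rfl | hv
    · simp
    · have hn := norm_ne_zero_iff.2 hv
      have : ‖v‖⁻¹ • v ∈ Metric.sphere (0 : EuclideanSpace ℝ (Fin p)) 1 := by
        simp [norm_smul, inv_mul_cancel₀ hn]
      have h1 : inner ℝ (Matrix.toEuclideanCLM (𝕜 := ℝ) H x) x ≤
        inner ℝ (Matrix.toEuclideanCLM (𝕜 := ℝ) H (‖v‖⁻¹ • v)) (‖v‖⁻¹ • v) := hmin this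
      rw [map_smul, inner_smul_left, inner_smul_right, conj_trivial] at h1
      calc _ ≤ (‖v‖⁻¹ * (‖v‖⁻¹ * inner ℝ (Matrix.toEuclideanCLM (𝕜 := ℝ) H v) v)) * ‖v‖ ^ 2 := by
            gcongr
        _ = _ := by field_simp

end Matrices

namespace CompositeModel

variable {p m K r : ℕ} {M : CompositeModel p m K}
  {g : EuclideanSpace ℝ (Fin p) → EuclideanSpace ℝ (Fin r)} {θ : EuclideanSpace ℝ (Fin p)}

/-- `P H = 1 + Q Gᵀ`. -/
theorem matrixP_mul_sensitivity (hH : (M.sensitivity θ).PosDef) :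
    M.matrixP g θ * M.sensitivity θ = 1 + M.matrixQ g θ * (constraintJacobian g θ)ᵀ := by
  have h : (M.sensitivity θ)⁻¹ * M.sensitivity θ = 1 :=
    Matrix.nonsing_inv_mul _ ((Matrix.isUnit_iff_isUnit_det _).1 hH.isUnit)
  rw [matrixP, add_mul, Matrix.mul_assoc (_ * _), h, Matrix.mul_one]

/-- `P G = 0`. -/
theorem matrixP_mul_constraintJacobian (hH : (M.sensitivity θ).PosDef)
    (hG : (constraintJacobian g θ).rank = r) :
    M.matrixP g θ * constraintJacobian g θ = 0 := by
  have hpd := hH.inv.conjTranspose_mul_mul_same (mulVec_injective_of_rank hG)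
  rw [Matrix.conjTranspose_eq_transpose_of_trivial] at hpd
  have h := Matrix.nonsing_inv_mul _ ((Matrix.isUnit_iff_isUnit_det _).1 hpd.isUnit)
  have hassoc : ∀ W : Matrix (Fin r) (Fin r) ℝ,
      (M.sensitivity θ)⁻¹ * constraintJacobian g θ * W * (constraintJacobian g θ)ᵀ *
        (M.sensitivity θ)⁻¹ * constraintJacobian g θ =
      (M.sensitivity θ)⁻¹ * constraintJacobian g θ * (W * ((constraintJacobian g θ)ᵀ *
        (M.sensitivity θ)⁻¹ * constraintJacobian g θ)) := fun W => by
    simp only [Matrix.mul_assoc]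
  rw [matrixP, matrixQ, Matrix.add_mul, Matrix.neg_mul, Matrix.neg_mul, Matrix.neg_mul, hassoc, h,
    Matrix.mul_one, add_neg_cancel]

variable {U : Set (EuclideanSpace ℝ (Fin p))}

/-! ### The composite likelihood as a smooth criterion -/

/-- The composite log-density agrees, for almost every observation, with a criterion that is smooth
and dominated for every observation. -/
theorem IsRegularAt.exists_smoothCriterion (h : M.IsRegularAt θ U) :
    ∃ L : (Fin m → ℝ) → EuclideanSpace ℝ (Fin p) → ℝ, SmoothCriterion (M.law θ) L U ∧
      ∀ᵐ y ∂(M.law θ), L y = fun t => M.compositeLogDensity t y := by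
  classical
  choose b hbi hb using h.dominated_hessian
  have hgood : ∀ᵐ y ∂(M.law θ), ∀ k, ContDiffOn ℝ 2 (fun t => M.logComponent k t y) U ∧
      ∀ t ∈ U, ‖iteratedFDeriv ℝ 2 (fun s => M.logComponent k s y) t‖ ≤ b k y :=
    ae_all_iff.2 fun k => (h.contDiffOn k).and (hb k)
  obtain ⟨N, hN, hNm, hN0⟩ := exists_measurable_superset_of_null (ae_iff.1 hgood)
  have hgood' : ∀ y ∉ N, ∀ k, ContDiffOn ℝ 2 (fun t => M.logComponent k t y) U ∧
      ∀ t ∈ U, ‖iteratedFDeriv ℝ 2 (fun s => M.logComponent k s y) t‖ ≤ b k y :=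
    fun y hy => not_not.1 fun hc => hy (hN hc)
  have hsmooth : ∀ y ∉ N, ContDiffOn ℝ 2 (fun t => M.compositeLogDensity t y) U := fun y hy =>
    ContDiffOn.sum fun k _ => contDiffOn_const.mul (hgood' y hy k).1
  refine ⟨fun y => if y ∈ N then 0 else fun t => M.compositeLogDensity t y,
    ⟨h.isOpen, fun t ht => ?_, fun y => ?_, fun y => ∑ k, M.w k * |b k y|, ?_, fun y t ht => ?_⟩, ?_⟩
  · have : (fun y => (if y ∈ N then 0 else fun t => M.compositeLogDensity t y :
        EuclideanSpace ℝ (Fin p) → ℝ) t) = fun y => if y ∈ N then 0 else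
          M.compositeLogDensity t y := by
      funext y; split_ifs <;> rfl
    rw [this]
    exact Measurable.ite hNm measurable_const (M.measurable_compositeLogDensity (h.subset ht))
  · split_ifs with hy
    · exact contDiffOn_const
    · exact hsmooth y hy
  · exact integrable_finsetSum _ fun k _ => (hbi k).abs.const_mul _
  · have hnn : 0 ≤ ∑ k, M.w k * |b k y| :=
      Finset.sum_nonneg fun k _ => mul_nonneg (M.w_nonneg k) (abs_nonneg _)
    split_ifs with hy
    · have h0 : gradient (0 : EuclideanSpace ℝ (Fin p) → ℝ) = fun _ => 0 := by
        funext s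
        rw [gradient_eq_rieszIsometry_comp, fderiv_zero]
        exact map_zero _
      rw [h0]
      simpa using hnn
    · have hcd : ∀ k, ContDiffAt ℝ 2 (fun t => M.logComponent k t y) t := fun k =>
        (hgood' y hy k).1.contDiffAt (h.isOpen.mem_nhds ht)
      have hd : DifferentiableAt ℝ (fderiv ℝ fun t => M.compositeLogDensity t y) t :=
        (((hsmooth y hy).contDiffAt (h.isOpen.mem_nhds ht)).fderiv_right (m := 1)
          (by norm_num)).differentiableAt (by norm_num)
      rw [norm_fderiv_gradient _ _ hd]
      simp only [compositeLogDensity]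
      rw [iteratedFDeriv_fun_sum_apply fun k _ => contDiffAt_const.mul (hcd k)]
      refine norm_sum_le_of_le _ fun k _ => ?_
      simp only [← smul_eq_mul (M.w k)]
      rw [iteratedFDeriv_const_smul_apply' (hcd k), norm_smul,
        Real.norm_of_nonneg (M.w_nonneg k)]
      exact mul_le_mul_of_nonneg_left (((hgood' y hy k).2 t ht).trans (le_abs_self _))
        (M.w_nonneg k)
  · filter_upwards [measure_eq_zero_iff_ae_notMem.1 hN0] with y hy
    simp [hy]

variable {L : (Fin m → ℝ) → EuclideanSpace ℝ (Fin p) → ℝ}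

theorem integrable_score (h : M.IsRegularAt θ U) :
    Integrable (M.score θ) (M.law θ) ∧ ∫ y, M.score θ y ∂(M.law θ) = 0 := by
  have hk := fun k => h.integrable_fderiv_logComponent k
  have hint : ∀ k, Integrable (fun y => M.w k • rieszIsometry _
      (fderiv ℝ (fun t => M.logComponent k t y) θ)) (M.law θ) := fun k =>
    ((rieszIsometry _).toContinuousLinearMap.integrable_comp (hk k).1).smul (M.w k)
  have hae : (fun y => ∑ k, M.w k • rieszIsometry _
      (fderiv ℝ (fun t => M.logComponent k t y) θ)) =ᵐ[M.law θ] M.score θ := by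
    filter_upwards [ae_all_iff.2 h.contDiffOn] with y hy
    have hd : ∀ k, DifferentiableAt ℝ (fun t => M.logComponent k t y) θ := fun k =>
      ((hy k).contDiffAt (h.isOpen.mem_nhds h.mem)).differentiableAt (by norm_num)
    simp only [score, gradient_eq_rieszIsometry_comp, compositeLogDensity]
    rw [fderiv_fun_sum fun k _ => (hd k).const_mul _, map_sum]
    refine Finset.sum_congr rfl fun k _ => ?_
    rw [fderiv_const_mul (hd k), map_smul]
  refine ⟨(integrable_finsetSum _ fun k _ => hint k).congr hae, ?_⟩
  rw [← integral_congr_ae hae, integral_finsetSum _ fun k _ => hint k]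
  refine Finset.sum_eq_zero fun k _ => ?_
  rw [integral_smul]
  have := (rieszIsometry _).toContinuousLinearMap.integral_comp_comm (hk k).1
  rw [(hk k).2, map_zero] at this
  exact (congrArg (M.w k • ·) this).trans (smul_zero _)

theorem score_eq_gradient {y : Fin m → ℝ} (hy : L y = fun t => M.compositeLogDensity t y)
    (t : EuclideanSpace ℝ (Fin p)) : M.score t y = gradient (L y) t := by
  rw [hy]; rfl

theorem integral_hessian_eq (hL : SmoothCriterion (M.law θ) L U) (hθ : θ ∈ U)
    (hLM : ∀ᵐ y ∂(M.law θ), L y = fun t => M.compositeLogDensity t y)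
    (hH : (M.sensitivity θ).PosDef) :
    ∫ y, fderiv ℝ (gradient (L y)) θ ∂(M.law θ) =
      -Matrix.toEuclideanCLM (𝕜 := ℝ) (M.sensitivity θ) := by
  obtain ⟨b, hb, hbound⟩ := hL.dominated
  have hint : Integrable (fun y => fderiv ℝ (gradient (L y)) θ) (M.law θ) :=
    hb.mono' (hL.measurable_hessian hθ).aestronglyMeasurable (.of_forall fun y => hbound y θ hθ)
  refine ContinuousLinearMap.coe_injective
    ((EuclideanSpace.basisFun (Fin p) ℝ).toBasis.ext fun i => ?_)
  ext j
  have hsym : M.sensitivity θ j i = M.sensitivity θ i j := by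
    simpa using (hH.isHermitian.apply i j)
  have hinti := hint.apply_continuousLinearMap (EuclideanSpace.single i (1 : ℝ))
  have hproj := (EuclideanSpace.proj (𝕜 := ℝ) j).integral_comp_comm hinti
  have hae : (fun y => -(fderiv ℝ (fun t => M.score t y) θ (EuclideanSpace.single i 1)) j)
      =ᵐ[M.law θ] fun y => -(fderiv ℝ (gradient (L y)) θ (EuclideanSpace.single i 1)) j := by
    filter_upwards [hLM] with y hy
    rw [show (fun t => M.score t y) = gradient (L y) from funext (score_eq_gradient hy)]
  have hS : M.sensitivity θ i j =
      -((∫ y, fderiv ℝ (gradient (L y)) θ ∂(M.law θ)) (EuclideanSpace.single i 1)) j := by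
    rw [sensitivity, Matrix.of_apply, integral_congr_ae hae, integral_neg,
      ContinuousLinearMap.integral_apply hint]
    exact congrArg _ hproj
  simp only [OrthonormalBasis.coe_toBasis, EuclideanSpace.basisFun_apply,
    ContinuousLinearMap.coe_coe, neg_apply, PiLp.neg_apply, Matrix.ofLp_toEuclideanCLM]
  have hcol : ((M.sensitivity θ) *ᵥ (EuclideanSpace.single i (1 : ℝ)).ofLp) j =
      M.sensitivity θ j i := by
    simp [EuclideanSpace.single]
  rw [hcol, hsym, hS, neg_neg]

end CompositeModel

/-! ### Asymptotic normality of restricted composite likelihood estimators -/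

theorem variance_inner_toEuclideanCLM {𝒴 : Type*} [MeasurableSpace 𝒴] {ν : Measure 𝒴}
    [IsProbabilityMeasure ν] {p : ℕ} {u : 𝒴 → EuclideanSpace ℝ (Fin p)} (hu : MemLp u 2 ν)
    (B : Matrix (Fin p) (Fin p) ℝ) (t : EuclideanSpace ℝ (Fin p)) :
    Var[fun y => inner ℝ (Matrix.toEuclideanCLM (𝕜 := ℝ) B (u y)) t; ν] =
      t ⬝ᵥ (B * (Matrix.of fun i j => cov[fun y => u y i, fun y => u y j; ν]) * Bᵀ) *ᵥ t := by
  have hui : ∀ i, MemLp (fun y => u y i) 2 ν := fun i =>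
    (EuclideanSpace.proj (𝕜 := ℝ) i).comp_memLp' hu
  set c : Fin p → ℝ := Bᵀ *ᵥ t.ofLp with hc
  have hexp : (fun y => inner ℝ (Matrix.toEuclideanCLM (𝕜 := ℝ) B (u y)) t) =
      fun y => ∑ i, c i * u y i := by
    funext y
    rw [real_inner_comm, Matrix.inner_toEuclideanCLM, Matrix.dotProduct_mulVec,
      ← Matrix.mulVec_transpose]
    rfl
  rw [hexp, variance_fun_sum fun i => (hui i).const_mul (c i)]
  simp only [covariance_const_mul_left, covariance_const_mul_right]
  rw [← Matrix.mulVec_mulVec, ← Matrix.mulVec_mulVec, Matrix.dotProduct_mulVec,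
    ← Matrix.mulVec_transpose, ← hc]
  clear_value c
  simp only [dotProduct, Matrix.mulVec, Matrix.of_apply, Finset.mul_sum]
  exact Finset.sum_congr rfl fun i _ => Finset.sum_congr rfl fun j _ => by ring

namespace CompositeModel

variable {p m K r : ℕ} {M : CompositeModel p m K}
  {g : EuclideanSpace ℝ (Fin p) → EuclideanSpace ℝ (Fin r)} {θ : EuclideanSpace ℝ (Fin p)}
  {U : Set (EuclideanSpace ℝ (Fin p))} {L : (Fin m → ℝ) → EuclideanSpace ℝ (Fin p) → ℝ}
  {Ω : Type*} [MeasurableSpace Ω] {μ : Measure Ω} {Y : ℕ → Ω → Fin m → ℝ}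

/-- Almost surely the composite log-likelihoods of all samples coincide with the sums of the smooth
criterion. -/
theorem ae_forall_criterion_eq (hLM : ∀ᵐ y ∂(M.law θ), L y = fun t => M.compositeLogDensity t y)
    (hY : ∀ i, Measurable (Y i)) (hlaw : ∀ i, μ.map (Y i) = M.law θ) :
    ∀ᵐ ω ∂μ, ∀ i, L (Y i ω) = fun t => M.compositeLogDensity t (Y i ω) :=
  ae_all_iff.2 fun i => ae_of_ae_map (hY i).aemeasurable ((hlaw i).symm ▸ hLM)

theorem compositeLogLik_eq {n : ℕ} {y : ℕ → Fin m → ℝ}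
    (hy : ∀ i, L (y i) = fun t => M.compositeLogDensity t (y i)) :
    M.compositeLogLik (fun i : Fin n => y i) = fun t => ∑ i : Fin n, L (y i) t := by
  funext t
  simp only [compositeLogLik, hy]

theorem solvesRestrictedEquations_iff {n : ℕ} {y : ℕ → Fin m → ℝ}
    (hy : ∀ i, L (y i) = fun t => M.compositeLogDensity t (y i)) {t : EuclideanSpace ℝ (Fin p)} :
    M.SolvesRestrictedEquations g (fun i : Fin n => y i) t ↔ t ∈ M.restrictedSpace g ∧
      ∃ l, ∑ i ∈ Finset.range n, gradient (L (y i)) t +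
        ContinuousLinearMap.adjoint (fderiv ℝ g t) l = 0 := by
  have key : ∀ l : EuclideanSpace ℝ (Fin r), (∑ i ∈ Finset.range n, gradient (L (y i)) t +
      ContinuousLinearMap.adjoint (fderiv ℝ g t) l = 0) ↔ ∀ a : Fin p,
        (∑ i : Fin n, M.score t (y i) a) + (constraintJacobian g t *ᵥ l.ofLp) a = 0 := by
    intro l
    rw [PiLp.ext_iff]
    refine forall_congr' fun a => ?_
    rw [adjoint_fderiv_apply, Finset.sum_range]
    simp [score_eq_gradient (hy _)]
  refine and_congr_right fun _ => ⟨?_, ?_⟩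
  · rintro ⟨lam, hlam⟩
    exact ⟨WithLp.toLp 2 lam, (key _).2 hlam⟩
  · rintro ⟨l, hl⟩
    exact ⟨l.ofLp, (key l).1 hl⟩

/-- Near `θ`, a local maximizer of the smooth criterion over the constraint set solves the restricted
likelihood equations. -/
theorem eventually_solvesRestrictedEquations (hsub : U ⊆ M.Θ) (hθ : θ ∈ U)
    (hL : SmoothCriterion (M.law θ) L U) (hdiff : ∀ t ∈ U, DifferentiableAt ℝ g t)
    (hcont : ContinuousOn (fderiv ℝ g) U) (hD : Function.Surjective (fderiv ℝ g θ)) :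
    ∀ᶠ t in 𝓝 θ, ∀ (n : ℕ) (y : ℕ → Fin m → ℝ),
      (∀ i, L (y i) = fun t => M.compositeLogDensity t (y i)) → g t = 0 →
      IsLocalMaxOn (fun t => ∑ i : Fin n, L (y i) t) {t | g t = 0} t →
      M.SolvesRestrictedEquations g (fun i : Fin n => y i) t := by
  have hU := hL.isOpen.mem_nhds hθ
  filter_upwards [hU, eventually_exists_multiplier hU hL.isOpen hdiff hcont hD]
    with t htU ht n y hy hgt hmax
  obtain ⟨l, hl⟩ := ht _ (hL.contDiffAt_sum Finset.univ (fun i : Fin n => y i) htU) hgt hmax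
  rw [hL.gradient_sum _ _ htU] at hl
  refine (solvesRestrictedEquations_iff hy).2 ⟨⟨hsub htU, hgt⟩, l, ?_⟩
  rwa [Finset.sum_range]

theorem isLocalMaxOn_of_isRestrictedMCLE (hU : IsOpen U) (hsub : U ⊆ M.Θ) {n : ℕ}
    {x : Fin n → Fin m → ℝ} {t : EuclideanSpace ℝ (Fin p)} (ht : t ∈ U)
    (h : M.IsRestrictedMCLE g x t) : IsLocalMaxOn (M.compositeLogLik x) {t | g t = 0} t := by
  filter_upwards [mem_nhdsWithin_of_mem_nhds (hU.mem_nhds ht), self_mem_nhdsWithin] with s hs hgs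
  exact h.2 ⟨hsub hs, hgs⟩

variable [IsProbabilityMeasure μ]

theorem tendstoInDistribution_sum_score (hreg : M.IsRegularAt θ U)
    (hL : SmoothCriterion (M.law θ) L U)
    (hLM : ∀ᵐ y ∂(M.law θ), L y = fun t => M.compositeLogDensity t y)
    (hJ : (M.variability θ).PosSemidef) (hY : ∀ i, Measurable (Y i))
    (hlaw : ∀ i, μ.map (Y i) = M.law θ) (hind : iIndepFun Y μ) (B : Matrix (Fin p) (Fin p) ℝ) :
    TendstoInDistribution (fun (n : ℕ) ω => (√(n : ℝ))⁻¹ • ∑ i ∈ Finset.range n,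
      Matrix.toEuclideanCLM (𝕜 := ℝ) B (gradient (L (Y i ω)) θ)) atTop id (fun _ => μ)
      (multivariateGaussian 0 (B * M.variability θ * Bᵀ)) := by
  have := M.isProbabilityMeasure_law hreg.mem_parameter
  have hum := hL.measurable_gradient hreg.mem
  have hus : M.score θ =ᵐ[M.law θ] fun y => gradient (L y) θ :=
    hLM.mono fun y hy => score_eq_gradient hy θ
  have hu2 : MemLp (fun y => gradient (L y) θ) 2 (M.law θ) := hreg.score_memLp.ae_eq hus
  have hvm : Measurable fun y => Matrix.toEuclideanCLM (𝕜 := ℝ) B (gradient (L y) θ) :=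
    (Matrix.toEuclideanCLM (𝕜 := ℝ) B).continuous.measurable.comp hum
  refine tendstoInDistribution_multivariateGaussian
    (X := fun i ω => Matrix.toEuclideanCLM (𝕜 := ℝ) B (gradient (L (Y i ω)) θ)) ?_ ?_
    (hind.comp (fun _ y => Matrix.toEuclideanCLM (𝕜 := ℝ) B (gradient (L y) θ)) fun _ => hvm)
    (fun i => (IdentDistrib.mk (hY i).aemeasurable (hY 0).aemeasurable
      (by rw [hlaw, hlaw])).comp hvm) ?_ fun t => ?_
  · have h2 := (Matrix.toEuclideanCLM (𝕜 := ℝ) B).comp_memLp' hu2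
    rw [← hlaw 0] at h2
    exact h2.comp_of_map (hY 0).aemeasurable
  · have h1 := integral_map (μ := μ) (hY 0).aemeasurable hvm.aestronglyMeasurable
    rw [← h1, hlaw 0, ContinuousLinearMap.integral_comp_comm _ (hu2.integrable (by norm_num)),
      ← integral_congr_ae hus, (integrable_score hreg).2, map_zero]
  · have := hJ.mul_mul_conjTranspose_same B
    rwa [Matrix.conjTranspose_eq_transpose_of_trivial] at this
  · have hin : Measurable fun y =>
        inner ℝ (Matrix.toEuclideanCLM (𝕜 := ℝ) B (gradient (L y) θ)) t := hvm.inner_const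
    have hvar := variance_map (μ := μ) hin.aemeasurable (hY 0).aemeasurable
    rw [hlaw 0] at hvar
    refine hvar.symm.trans (Eq.trans ?_ (variance_inner_toEuclideanCLM hreg.score_memLp B t))
    exact variance_congr (hus.mono fun y hy => by simp only [hy])

/-- Consistent restricted estimators are asymptotically normal. -/
theorem tendstoInDistribution_restricted (hreg : M.IsRegularAt θ U)
    (hH : (M.sensitivity θ).PosDef) (hJ : (M.variability θ).PosDef)
    (hdiff : ∀ t ∈ U, DifferentiableAt ℝ g t) (hcont : ContinuousOn (fderiv ℝ g) U)
    (hrank : (constraintJacobian g θ).rank = r) (hgθ : g θ = 0)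
    (hY : ∀ i, Measurable (Y i)) (hlaw : ∀ i, μ.map (Y i) = M.law θ) (hind : iIndepFun Y μ)
    {T : ℕ → Ω → EuclideanSpace ℝ (Fin p)} (hTm : ∀ n, AEMeasurable (T n) μ)
    (hT : TendstoInMeasure μ T atTop fun _ => θ)
    (hest : HoldsWHP μ fun n ω => M.IsRestrictedMCLE g (fun i : Fin n => Y i ω) (T n ω) ∨
      M.SolvesRestrictedEquations g (fun i : Fin n => Y i ω) (T n ω)) :
    TendstoInDistribution (fun (n : ℕ) ω => √(n : ℝ) • (T n ω - θ)) atTop id (fun _ => μ)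
      (multivariateGaussian 0 (M.restrictedCovariance g θ)) := by
  obtain ⟨L, hL, hLM⟩ := hreg.exists_smoothCriterion
  have hD := surjective_fderiv_of_rank hrank
  have hclt := tendstoInDistribution_sum_score hreg hL hLM hJ.posSemidef hY hlaw hind
  have hsol : HoldsWHP μ fun n ω => g (T n ω) = 0 ∧ ∃ l, ∑ i ∈ Finset.range n,
      gradient (L (Y i ω)) (T n ω) +
        ContinuousLinearMap.adjoint (fderiv ℝ g (T n ω)) l = 0 := by
    obtain ⟨δ, hδ, hnear⟩ := Metric.eventually_nhds_iff.1
      (Filter.Eventually.and (hreg.isOpen.mem_nhds hreg.mem)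
        (eventually_solvesRestrictedEquations hreg.subset hreg.mem hL hdiff hcont hD))
    refine (hest.and (HoldsWHP.norm_sub_lt hT hδ)).mono (.of_forall fun n => ?_)
    filter_upwards [ae_forall_criterion_eq hLM hY hlaw] with ω hω ⟨h1, h2⟩
    obtain ⟨htU, hs⟩ := hnear (y := T n ω) (by rwa [dist_eq_norm])
    have hsolves : M.SolvesRestrictedEquations g (fun i : Fin n => Y i ω) (T n ω) := by
      refine h1.elim (fun hm => ?_) id
      refine hs n (fun i => Y i ω) hω hm.1.2 ?_
      rw [← compositeLogLik_eq hω]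
      exact isLocalMaxOn_of_isRestrictedMCLE hreg.isOpen hreg.subset htU hm
    obtain ⟨hmem, hl⟩ := (solvesRestrictedEquations_iff hω).1 hsolves
    exact ⟨hmem.2, hl⟩
  have htight : ∀ η : ℝ≥0∞, 0 < η → ∃ R > 0, ∀ᶠ n : ℕ in atTop,
      μ {ω | R ≤ ‖(√(n : ℝ))⁻¹ • ∑ i ∈ Finset.range n, gradient (L (Y i ω)) θ‖} ≤ η := by
    intro η hη
    simpa using exists_eventually_measure_norm_ge_le (hclt 1) hη
  have hlinear := tendstoInMeasure_restricted_sub hL hreg.mem hY hlaw hind hdiff hcont hD hgθ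
    (H := Matrix.toEuclideanCLM (𝕜 := ℝ) (M.sensitivity θ))
    (P := Matrix.toEuclideanCLM (𝕜 := ℝ) (M.matrixP g θ))
    (Q := (Matrix.toEuclideanLin (M.matrixQ g θ)).toContinuousLinearMap)
    (integral_hessian_eq hL hreg.mem hLM hH)
    (fun v => by
      have h := congrArg (fun A => WithLp.toLp 2 (A *ᵥ v.ofLp)) (matrixP_mul_sensitivity (g := g) hH)
      simp only [← Matrix.mulVec_mulVec, Matrix.add_mulVec, Matrix.one_mulVec] at h
      rw [fderiv_apply_constraintJacobian]
      exact h)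
    (fun l => by
      have h := congrArg (fun A => WithLp.toLp 2 (A *ᵥ l.ofLp))
        (matrixP_mul_constraintJacobian (g := g) hH hrank)
      simp only [← Matrix.mulVec_mulVec, Matrix.zero_mulVec] at h
      rw [adjoint_fderiv_apply]
      exact h)
    htight hT hsol
  refine tendstoInDistribution_of_tendstoInMeasure_sub _ _ (hclt (M.matrixP g θ)) ?_
    fun n => ((hTm n).sub_const θ).const_smul (√(n : ℝ))
  convert hlinear using 1
  funext n ω
  simp [map_sum]

end CompositeModel

theorem theorem3 {p m K r : ℕ} (hr : r < p) (M : CompositeModel p m K)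
    (g : EuclideanSpace ℝ (Fin p) → EuclideanSpace ℝ (Fin r))
    (θ : EuclideanSpace ℝ (Fin p)) (U : Set (EuclideanSpace ℝ (Fin p)))
    (hreg : M.IsRegularAt θ U)
    (hH : (M.sensitivity θ).PosDef) (hJ : (M.variability θ).PosDef)
    (hg_diff : ∀ t ∈ interior M.Θ, DifferentiableAt ℝ g t)
    (hg_cont : ContinuousOn (CompositeModel.constraintJacobian g) (interior M.Θ))
    (hg_rank : (CompositeModel.constraintJacobian g θ).rank = r)
    (hg_zero : g θ = 0)
    {Ω : Type*} [MeasurableSpace Ω] (μ : Measure Ω) [IsProbabilityMeasure μ]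
    (Y : ℕ → Ω → Fin m → ℝ) (hY_meas : ∀ i, Measurable (Y i))
    (hY_law : ∀ i, μ.map (Y i) = M.law θ) (hY_indep : iIndepFun Y μ) :
    (∀ θrc : ℕ → Ω → EuclideanSpace ℝ (Fin p), (∀ n, AEMeasurable (θrc n) μ) →
      TendstoInMeasure μ θrc atTop (fun _ => θ) →
      Tendsto (fun n => μ {ω | ¬ (M.IsRestrictedMCLE g (fun i : Fin n => Y i ω) (θrc n ω) ∨
        M.SolvesRestrictedEquations g (fun i : Fin n => Y i ω) (θrc n ω))}) atTop (𝓝 0) →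
      TendstoInDistribution (fun (n : ℕ) ω => √(n : ℝ) • (θrc n ω - θ)) atTop id (fun _ => μ)
        (multivariateGaussian 0 (M.restrictedCovariance g θ))) ∧
    (∃ T : (n : ℕ) → (Fin n → Fin m → ℝ) → EuclideanSpace ℝ (Fin p),
      (∀ n, Measurable (T n)) ∧
      TendstoInMeasure μ (fun n ω => T n (fun i : Fin n => Y i ω)) atTop (fun _ => θ) ∧
      Tendsto (fun n => μ {ω |
        ¬ (M.IsLocalRestrictedMCLE g (fun i : Fin n => Y i ω) (T n (fun i : Fin n => Y i ω)) ∧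
          M.SolvesRestrictedEquations g (fun i : Fin n => Y i ω)
            (T n (fun i : Fin n => Y i ω)))}) atTop (𝓝 0) ∧
      TendstoInDistribution
        (fun (n : ℕ) ω => √(n : ℝ) • (T n (fun i : Fin n => Y i ω) - θ)) atTop id (fun _ => μ)
        (multivariateGaussian 0 (M.restrictedCovariance g θ))) := by
  have hUint : U ⊆ interior M.Θ := interior_maximal hreg.subset hreg.isOpen
  have hdiff : ∀ t ∈ U, DifferentiableAt ℝ g t := fun t ht => hg_diff t (hUint ht)
  have hcont := continuousOn_fderiv_of_constraintJacobian (hg_cont.mono hUint)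
  refine ⟨fun T hTm hT hest => CompositeModel.tendstoInDistribution_restricted hreg hH hJ hdiff
    hcont hg_rank hg_zero hY_meas hY_law hY_indep hTm hT hest, ?_⟩
  obtain ⟨L, hL, hLM⟩ := hreg.exists_smoothCriterion
  obtain ⟨a, ha, hpos⟩ := exists_pos_le_inner_toEuclideanCLM hH
  have hscore : M.score θ =ᵐ[M.law θ] fun y => gradient (L y) θ :=
    hLM.mono fun y hy => CompositeModel.score_eq_gradient hy θ
  have hs := CompositeModel.integrable_score hreg
  obtain ⟨T, hTm, hT, hmax⟩ := exists_measurable_consistent_local_maximizer hL hreg.mem hY_meas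
    hY_law hY_indep hdiff hg_zero ha
    (fun v => by
      rw [CompositeModel.integral_hessian_eq hL hreg.mem hLM hH, neg_apply, inner_neg_left]
      linarith [hpos v])
    (hs.1.congr hscore) ((integral_congr_ae hscore).symm.trans hs.2)
  have hboth : HoldsWHP μ fun n ω =>
      M.IsLocalRestrictedMCLE g (fun i : Fin n => Y i ω) (T n fun i : Fin n => Y i ω) ∧
        M.SolvesRestrictedEquations g (fun i : Fin n => Y i ω) (T n fun i : Fin n => Y i ω) := by
    obtain ⟨δ, hδ, hnear⟩ := Metric.eventually_nhds_iff.1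
      (CompositeModel.eventually_solvesRestrictedEquations hreg.subset hreg.mem hL hdiff hcont
        (surjective_fderiv_of_rank hg_rank))
    refine (hmax.and (HoldsWHP.norm_sub_lt hT hδ)).mono (.of_forall fun n => ?_)
    filter_upwards [CompositeModel.ae_forall_criterion_eq hLM hY_meas hY_law]
      with ω hω ⟨⟨h1, h2⟩, h3⟩
    have hsolves := hnear (by rwa [dist_eq_norm]) n (fun i => Y i ω) hω h1 h2
    refine ⟨⟨hsolves.1, ?_⟩, hsolves⟩
    rw [CompositeModel.compositeLogLik_eq hω]
    exact h2.on_subset fun t ht => ht.2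
  refine ⟨T, hTm, hT, hboth, CompositeModel.tendstoInDistribution_restricted hreg hH hJ hdiff
    hcont hg_rank hg_zero hY_meas hY_law hY_indep (fun n => ?_) hT
    (hboth.mono (.of_forall fun n => .of_forall fun ω hω => Or.inr hω.2))⟩
  exact ((hTm n).comp (measurable_pi_lambda _ fun i => hY_meas i)).aemeasurable
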